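/- Setting. Let $N_B\ge 0$, $0<\eta<1$, $M\in\mathbb N$. Let $\rho_{\rm th}(N)=\sum_{n\ge0}\frac{N^n}{(N+1)^{n+1}}|n\rangle\langle n|$ be the single-mode thermal state of mean photon number $N$. For $0\le\kappa\le1$ let $\mathcal L_{\kappa,N}$ be the thermal loss channel: the input mode $a$ is mixed with a background mode $b$ in state $\rho_{\rm th}(N)$ on a beam splitter with output modes $\sqrt\kappa\,a+\sqrt{1-\kappa}\,b$ and $\sqrt{1-\kappa}\,a-\sqrt\kappa\,b$, and the second output mode is traced out. A probe with $M$ signal modes $S$ and an idler $I$ (an arbitrary complex Hilbert space) is $\Psi=|\psi\rangle\langle\psi|$ with $|\psi\rangle=\sum_{\mathbf n\in\mathbb N^M}\sqrt{p_{\mathbf n}}\,|\chi_{\mathbf n}\rangle_I|\mathbf n\rangle_S$, where $(p_{\mathbf n})$ is a probability distribution and the $\chi_{\mathbf n}$ are unit vectors, not necessarily orthogonal. Define $$\rho_0=(\mathrm{Tr}_S\Psi)\otimes\rho_{\rm th}(N_B)^{\otimes M},\quad \rho_1=(\mathrm{id}_I\otimes\mathcal L_{\eta,N_B}^{\otimes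 M})\Psi,\quad \sigma_0=\rho_{\rm th}(N_B)^{\otimes M},\quad \sigma_1=\mathcal L_{1-\eta,N_B}^{\otimes M}(\mathrm{Tr}_I\Psi),$$ $$P_e^A=\tfrac12-\tfrac14\|\rho_0-\rho_1\|_1,\qquad P_e^W=\tfrac12-\tfrac14\|\sigma_0-\sigma_1\|_1,\qquad \|X\|_1=\mathrm{Tr}\sqrt{X^\dagger X}.$$ For $0\le\epsilon\le\frac12$ the probe is $\epsilon$-covert if $P_e^W\ge\frac12-\epsilon$. Put $$\Theta=\frac{\sqrt{(1-\eta)(N_B+1)}}{\sqrt{1+(1-\eta)N_B}},\qquad x=1-\frac{1-\Theta}{1-\eta[1+N_B(1-\Theta)]},$$ $$\nu=\Big(\sqrt{G_0G_1}-\sqrt{(G_0-1)(G_1-1)}\Big)^{-1},\quad G_0=N_B+1,\ G_1=(1-\eta)N_B+1,$$ $$f_{\eta,N_B}=\nu\Big(N_B+1-\frac{N_B}{x}\Big)\big[\eta N_B(1-x)+1\big]$$ (with $N_B/x$ read as $0$ if $N_B=0$). The convergence condition is: $1-\eta[1+N_B(1-\Theta)]\neq0$ and $\frac{N_B}{N_B+1}\le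 x\le1$. Statement. (i) If $\eta\le 0.4$, the convergence condition holds for every $N_B\ge0$. (ii) Whenever the convergence condition holds, every $\epsilon$-covert probe with $M$ signal modes satisfies $$P_e^A\ \ge\ \frac{1-\sqrt{1-(1-2\epsilon)^4 f_{\eta,N_B}^{2M}}}{2}.$$ -/

import Mathlib

open scoped ENNReal InnerProductSpace

noncomputable section

namespace CovertQI

/-! ### Beam splitter -/

/-- The Fischer (Fock) pairing on two-mode polynomials, `⟨x^d, x^e⟩ = δ_{de} ∏ dᵢ!`. -/
def fischer (f g : MvPolynomial (Fin 2) ℝ) : ℝ :=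
  ∑ d ∈ f.support, ((d 0).factorial * (d 1).factorial : ℝ) * f.coeff d * g.coeff d

lemma fischer_eq_of_subset {f : MvPolynomial (Fin 2) ℝ} (g : MvPolynomial (Fin 2) ℝ)
    {s : Finset (Fin 2 →₀ ℕ)} (hs : f.support ⊆ s) :
    fischer f g = ∑ d ∈ s, ((d 0).factorial * (d 1).factorial : ℝ) * f.coeff d * g.coeff d := by
  refine Finset.sum_subset hs fun d _ hd => ?_
  rw [MvPolynomial.notMem_support_iff.mp hd]; ring

lemma fischer_comm (f g : MvPolynomial (Fin 2) ℝ) : fischer f g = fischer g f := by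
  classical
  rw [fischer_eq_of_subset g (Finset.subset_union_left (s₂ := g.support)),
    fischer_eq_of_subset f (Finset.subset_union_right (s₁ := f.support))]
  exact Finset.sum_congr rfl fun d _ => by ring

lemma fischer_add_left (f f' g : MvPolynomial (Fin 2) ℝ) :
    fischer (f + f') g = fischer f g + fischer f' g := by
  classical
  rw [fischer_eq_of_subset g (MvPolynomial.support_add (p := f) (q := f')),
    fischer_eq_of_subset g (Finset.subset_union_left (s₂ := f'.support)),
    fischer_eq_of_subset g (Finset.subset_union_right (s₁ := f.support)),
    ← Finset.sum_add_distrib]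
  exact Finset.sum_congr rfl fun d _ => by rw [MvPolynomial.coeff_add]; ring

lemma fischer_add_right (f g g' : MvPolynomial (Fin 2) ℝ) :
    fischer f (g + g') = fischer f g + fischer f g' := by
  rw [fischer_comm, fischer_add_left, fischer_comm g, fischer_comm g']

lemma fischer_smul_left (c : ℝ) (f g : MvPolynomial (Fin 2) ℝ) :
    fischer (MvPolynomial.C c * f) g = c * fischer f g := by
  classical
  have hs : (MvPolynomial.C c * f).support ⊆ f.support := fun d hd => by
    rw [MvPolynomial.mem_support_iff, MvPolynomial.coeff_C_mul] at hd
    exact MvPolynomial.mem_support_iff.mpr (right_ne_zero_of_mul hd)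
  rw [fischer_eq_of_subset g hs, fischer, Finset.mul_sum]
  exact Finset.sum_congr rfl fun d _ => by rw [MvPolynomial.coeff_C_mul]; ring

lemma fischer_smul_right (c : ℝ) (f g : MvPolynomial (Fin 2) ℝ) :
    fischer f (MvPolynomial.C c * g) = c * fischer f g := by
  rw [fischer_comm, fischer_smul_left, fischer_comm]

lemma fischer_monomial (d : Fin 2 →₀ ℕ) (a : ℝ) (g : MvPolynomial (Fin 2) ℝ) :
    fischer (MvPolynomial.monomial d a) g =
      ((d 0).factorial * (d 1).factorial : ℝ) * a * g.coeff d := by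
  classical
  rw [fischer_eq_of_subset g MvPolynomial.support_monomial_subset]
  simp

lemma fischer_X_mul (i : Fin 2) (f g : MvPolynomial (Fin 2) ℝ) :
    fischer (MvPolynomial.X i * f) g = fischer f (MvPolynomial.pderiv i g) := by
  induction f using MvPolynomial.induction_on' with
  | monomial d a =>
    rw [mul_comm, MvPolynomial.X, MvPolynomial.monomial_mul, mul_one, fischer_monomial,
      fischer_monomial, MvPolynomial.coeff_pderiv]
    fin_cases i <;> simp [Nat.factorial_succ] <;> ring
  | add p q hp hq => rw [mul_add, fischer_add_left, fischer_add_left, hp, hq]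

/-- The two-mode polynomial `(√κ x + √(1-κ) y)ⁿ (√(1-κ) x - √κ y)ᵐ`. With `x`, `y` read as the
creation operators of the two output modes, applying it to the two-mode vacuum gives
`√(n! m!) U|n, m⟩`, where `U` is the beam splitter of transmittance `κ`, i.e.
`U† a U = √κ a + √(1-κ) b` and `U† b U = √(1-κ) a - √κ b`. -/
def bsPoly (κ : unitInterval) (n m : ℕ) : MvPolynomial (Fin 2) ℝ :=
  (MvPolynomial.C (√(κ : ℝ)) * MvPolynomial.X 0
      + MvPolynomial.C (√(1 - (κ : ℝ))) * MvPolynomial.X 1) ^ n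
    * (MvPolynomial.C (√(1 - (κ : ℝ))) * MvPolynomial.X 0
      - MvPolynomial.C (√(κ : ℝ)) * MvPolynomial.X 1) ^ m

/-- The number-basis amplitude `⟨j, k|U|n, m⟩` of the beam splitter of transmittance `κ`; the
first entry of each pair is the signal (resp. transmitted) mode, the second the background
(resp. environment) mode. -/
def bsAmp (κ : unitInterval) (n m j k : ℕ) : ℝ :=
  √((j.factorial * k.factorial : ℝ) / (n.factorial * m.factorial)) *
    (bsPoly κ n m).coeff (Finsupp.single 0 j + Finsupp.single 1 k)

lemma fischer_bsPoly (κ : unitInterval) (n m : ℕ) :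
    fischer (bsPoly κ n m) (bsPoly κ n m) = n.factorial * m.factorial := by
  have ht : √(κ : ℝ) * √(κ : ℝ) = κ := Real.mul_self_sqrt κ.2.1
  have hr : √(1 - (κ : ℝ)) * √(1 - (κ : ℝ)) = 1 - κ :=
    Real.mul_self_sqrt (sub_nonneg.mpr κ.2.2)
  set t := √(κ : ℝ)
  set r := √(1 - (κ : ℝ))
  set P : MvPolynomial (Fin 2) ℝ :=
    MvPolynomial.C t * MvPolynomial.X 0 + MvPolynomial.C r * MvPolynomial.X 1 with hP
  set Q : MvPolynomial (Fin 2) ℝ :=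
    MvPolynomial.C r * MvPolynomial.X 0 - MvPolynomial.C t * MvPolynomial.X 1 with hQ
  have hb : ∀ n m, bsPoly κ n m = P ^ n * Q ^ m := fun _ _ => rfl
  have hPP : MvPolynomial.C t * MvPolynomial.C t + MvPolynomial.C r * MvPolynomial.C r
      = (1 : MvPolynomial (Fin 2) ℝ) := by
    rw [← MvPolynomial.C_mul, ← MvPolynomial.C_mul, ← MvPolynomial.C_add, ht, hr]; simp
  have h0P : MvPolynomial.pderiv 0 P = MvPolynomial.C t := by
    simp [hP]
  have h1P : MvPolynomial.pderiv 1 P = MvPolynomial.C r := by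
    simp [hP]
  have h0Q : MvPolynomial.pderiv 0 Q = MvPolynomial.C r := by
    simp [hQ]
  have h1Q : MvPolynomial.pderiv 1 Q = -MvPolynomial.C t := by
    simp [hQ]
  have adjP : ∀ f g, fischer (P * f) g = fischer f
      (MvPolynomial.C t * MvPolynomial.pderiv 0 g + MvPolynomial.C r * MvPolynomial.pderiv 1 g) := by
    intro f g
    rw [hP, add_mul, fischer_add_left, mul_assoc, mul_assoc, fischer_smul_left, fischer_smul_left,
      fischer_X_mul, fischer_X_mul, fischer_add_right, fischer_smul_right, fischer_smul_right]
  have adjQ : ∀ f g, fischer (Q * f) g = fischer f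
      (MvPolynomial.C r * MvPolynomial.pderiv 0 g
        + MvPolynomial.C (-t) * MvPolynomial.pderiv 1 g) := by
    intro f g
    have : Q = MvPolynomial.C r * MvPolynomial.X 0 + MvPolynomial.C (-t) * MvPolynomial.X 1 := by
      rw [hQ, MvPolynomial.C_neg]; ring
    rw [this, add_mul, fischer_add_left, mul_assoc, mul_assoc, fischer_smul_left,
      fischer_smul_left, fischer_X_mul, fischer_X_mul, fischer_add_right, fischer_smul_right,
      fischer_smul_right]
  induction n with
  | succ n ih =>
    have e : bsPoly κ (n + 1) m = P * bsPoly κ n m := by rw [hb, hb]; ring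
    rw [e, adjP]
    have d : MvPolynomial.C t * MvPolynomial.pderiv 0 (P * bsPoly κ n m)
        + MvPolynomial.C r * MvPolynomial.pderiv 1 (P * bsPoly κ n m)
        = MvPolynomial.C ((n : ℝ) + 1) * bsPoly κ n m := by
      have hn : P * P ^ (n - 1) * (n : MvPolynomial (Fin 2) ℝ) = n * P ^ n := by
        cases n with
        | zero => simp
        | succ k => simp; ring
      rw [hb]
      simp only [Derivation.leibniz, Derivation.leibniz_pow, smul_eq_mul, nsmul_eq_mul,
        h0P, h1P, h0Q, h1Q, map_add, MvPolynomial.C_1, map_natCast]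
      linear_combination (P ^ n * Q ^ m) * hPP
        + (P * P ^ (n - 1) * (n : MvPolynomial (Fin 2) ℝ) * Q ^ m) * hPP + Q ^ m * hn
    rw [d, fischer_smul_right, ih, Nat.factorial_succ]
    push_cast; ring
  | zero =>
    induction m with
    | succ m ih =>
      have e : bsPoly κ 0 (m + 1) = Q * bsPoly κ 0 m := by rw [hb, hb]; ring
      rw [e, adjQ]
      have d : MvPolynomial.C r * MvPolynomial.pderiv 0 (Q * bsPoly κ 0 m)
          + MvPolynomial.C (-t) * MvPolynomial.pderiv 1 (Q * bsPoly κ 0 m)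
          = MvPolynomial.C ((m : ℝ) + 1) * bsPoly κ 0 m := by
        have hn : Q * Q ^ (m - 1) * (m : MvPolynomial (Fin 2) ℝ) = m * Q ^ m := by
          cases m with
          | zero => simp
          | succ k => simp; ring
        rw [hb]
        simp only [pow_zero, one_mul, Derivation.leibniz, Derivation.leibniz_pow, smul_eq_mul,
          nsmul_eq_mul, h0Q, h1Q, map_add, MvPolynomial.C_1, map_natCast, MvPolynomial.C_neg]
        linear_combination (Q ^ m) * hPP
          + (Q * Q ^ (m - 1) * (m : MvPolynomial (Fin 2) ℝ)) * hPP + hn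
      rw [d, fischer_smul_right, ih, Nat.factorial_succ]
      push_cast; ring
    | zero =>
      rw [hb]
      have : (P ^ 0 * Q ^ 0 : MvPolynomial (Fin 2) ℝ) = MvPolynomial.monomial 0 1 := by simp
      rw [this, fischer_monomial]
      simp

lemma abs_bsAmp_le_one (κ : unitInterval) (n m j k : ℕ) : |bsAmp κ n m j k| ≤ 1 := by
  classical
  set d : Fin 2 →₀ ℕ := Finsupp.single 0 j + Finsupp.single 1 k with hd
  have h0 : d 0 = j := by simp [hd]
  have h1 : d 1 = k := by simp [hd]
  have key : (j.factorial * k.factorial : ℝ) * (bsPoly κ n m).coeff d ^ 2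
      ≤ n.factorial * m.factorial := by
    rw [← fischer_bsPoly κ n m,
      fischer_eq_of_subset _ (Finset.subset_insert d (bsPoly κ n m).support)]
    have := Finset.single_le_sum
      (f := fun e : Fin 2 →₀ ℕ => ((e 0).factorial * (e 1).factorial : ℝ)
        * (bsPoly κ n m).coeff e * (bsPoly κ n m).coeff e)
      (fun e _ => by
        rw [mul_assoc]; exact mul_nonneg (by positivity) (mul_self_nonneg _))
      (Finset.mem_insert_self d (bsPoly κ n m).support)
    simp only [h0, h1] at this
    refine le_trans (le_of_eq ?_) this
    ring
  have hpos : (0 : ℝ) < n.factorial * m.factorial := by positivity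
  rw [← sq_le_one_iff_abs_le_one, bsAmp, mul_pow, Real.sq_sqrt (by positivity), div_mul_eq_mul_div,
    div_le_one hpos]
  exact key

/-! ### States and channels

The space of an `M`-mode bosonic system together with an auxiliary system `H` is `ℓ²(ℕᴹ; H)`, the
Hilbert tensor product of `H` with the `M`-mode Fock space; `ψ n` is the `H`-component of `ψ` along
the number state `|n⟩`. The `M`-mode Fock space itself is the case `H = ℂ`. -/

/-- `H ⊗ (M-mode Fock space)`, realised as `ℓ²(ℕᴹ; H)`. -/
abbrev Modes (M : ℕ) (H : Type*) [NormedAddCommGroup H] : Type _ :=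
  lp (fun _ : Fin M → ℕ => H) 2

variable {M : ℕ} {H : Type*} [NormedAddCommGroup H] [InnerProductSpace ℂ H]

/-- Amplitudes of `(1_H ⊗ ⟨k|U^{⊗M}|m⟩) ψ`: since `U` conserves the photon number of each pair of
modes, only `|j + k - m⟩` contributes to the component along `|j⟩`. -/
def krausFun (κ : unitInterval) (m k : Fin M → ℕ) (ψ : (Fin M → ℕ) → H) (j : Fin M → ℕ) : H :=
  open Classical in
  if m ≤ j + k then
    ((∏ i, bsAmp κ ((j + k - m) i) (m i) (j i) (k i) : ℝ) : ℂ) • ψ (j + k - m)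
  else 0

lemma sum_krausFun_le (κ : unitInterval) (m k : Fin M → ℕ) (ψ : Modes M H)
    (s : Finset (Fin M → ℕ)) :
    ∑ j ∈ s, ‖krausFun κ m k (ψ : (Fin M → ℕ) → H) j‖ ^ (2 : ℝ≥0∞).toReal
      ≤ ‖ψ‖ ^ (2 : ℝ≥0∞).toReal := by
  classical
  have h2 : 0 < (2 : ℝ≥0∞).toReal := by norm_num
  have hz : ∀ j ∈ s, j ∉ s.filter (fun j => m ≤ j + k) →
      ‖krausFun κ m k (ψ : (Fin M → ℕ) → H) j‖ ^ (2 : ℝ≥0∞).toReal = 0 := by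
    intro j hj hj'
    have : ¬ m ≤ j + k := fun h => hj' (Finset.mem_filter.mpr ⟨hj, h⟩)
    simp [krausFun, this]
  rw [← Finset.sum_subset (Finset.filter_subset (fun j => m ≤ j + k) s) hz]
  have hinj : Set.InjOn (fun j : Fin M → ℕ => j + k - m)
      (s.filter (fun j => m ≤ j + k) : Set (Fin M → ℕ)) := by
    intro a ha b hb hab
    have ha' := (Finset.mem_filter.mp (Finset.mem_coe.mp ha)).2
    have hb' := (Finset.mem_filter.mp (Finset.mem_coe.mp hb)).2
    funext i
    have h1 := ha' i
    have h2 := hb' i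
    have h3 := congrFun hab i
    simp only [Pi.add_apply, Pi.sub_apply] at h1 h2 h3
    omega
  calc ∑ j ∈ s.filter (fun j => m ≤ j + k),
        ‖krausFun κ m k (ψ : (Fin M → ℕ) → H) j‖ ^ (2 : ℝ≥0∞).toReal
      ≤ ∑ j ∈ s.filter (fun j => m ≤ j + k), ‖ψ (j + k - m)‖ ^ (2 : ℝ≥0∞).toReal := by
        refine Finset.sum_le_sum fun j hj => ?_
        have hj' := (Finset.mem_filter.mp hj).2
        refine Real.rpow_le_rpow (norm_nonneg _) ?_ h2.le
        rw [krausFun, if_pos hj', norm_smul, Complex.norm_real, Real.norm_eq_abs,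
          Finset.abs_prod]
        exact mul_le_of_le_one_left (norm_nonneg _)
          (Finset.prod_le_one (fun _ _ => abs_nonneg _) fun _ _ => abs_bsAmp_le_one ..)
    _ = ∑ n ∈ (s.filter (fun j => m ≤ j + k)).image (fun j => j + k - m),
          ‖ψ n‖ ^ (2 : ℝ≥0∞).toReal := by
        rw [Finset.sum_image hinj]
    _ ≤ ‖ψ‖ ^ (2 : ℝ≥0∞).toReal := lp.sum_rpow_le_norm_rpow h2 ψ _

/-- `1_H ⊗ ⟨k|U^{⊗M}|m⟩`, where `U` is the beam splitter of transmittance `κ` and `⟨k|`, `|m⟩` are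
number states of the background modes: the Kraus operators of the beam splitter for background
input `|m⟩`. -/
def kraus (κ : unitInterval) (m k : Fin M → ℕ) : Modes M H →L[ℂ] Modes M H :=
  LinearMap.mkContinuous
    { toFun := fun ψ => ⟨krausFun κ m k ψ, memℓp_gen' (sum_krausFun_le κ m k ψ)⟩
      map_add' := fun ψ φ => by
        ext j
        change krausFun κ m k (fun n => ψ n + φ n) j = krausFun κ m k ψ j + krausFun κ m k φ j
        by_cases h : m ≤ j + k <;> simp [krausFun, h, smul_add]
      map_smul' := fun c ψ => by
        ext j
        by_cases h : m ≤ j + k <;> simp [krausFun, h, smul_comm c] }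
    1 fun ψ => by
      rw [one_mul]
      exact lp.norm_le_of_forall_sum_le (by norm_num) (norm_nonneg _) (sum_krausFun_le κ m k ψ)

/-- Number distribution of `ρ_th(N)^{⊗M}`, the `M`-mode thermal state with `N` mean photons per
mode. -/
def thermalPMF (N : ℝ) (n : Fin M → ℕ) : ℝ :=
  ∏ i, N ^ n i / (N + 1) ^ (n i + 1)

variable [CompleteSpace H]

open ContinuousLinearMap in
/-- `id_H ⊗ L_{κ,N}^{⊗M}`, with `L_{κ,N}` the thermal loss channel: each mode is mixed, on a beam
splitter of transmittance `κ`, with a background mode in the thermal state of mean photon number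
`N`, and the second output mode of each beam splitter is traced out, i.e.
`X ↦ ∑_{m,k} p_th(m) K_{m,k} X K_{m,k}†`. The sum converges in norm on trace-class operators. -/
def thermalLoss (κ : unitInterval) (N : ℝ) (X : Modes M H →L[ℂ] Modes M H) :
    Modes M H →L[ℂ] Modes M H :=
  ∑' e : (Fin M → ℕ) × (Fin M → ℕ),
    ((thermalPMF N e.1 : ℝ) : ℂ) • (kraus κ e.1 e.2 ∘L X ∘L adjoint (kraus κ e.1 e.2))

/-- `X ⊗ ρ_th(N)^{⊗M} = ∑ₙ p_th(n) (X ⊗ |n⟩⟨n|)`. -/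
def tensorThermal (M : ℕ) (N : ℝ) (X : H →L[ℂ] H) : Modes M H →L[ℂ] Modes M H :=
  ∑' n : Fin M → ℕ, ((thermalPMF N n : ℝ) : ℂ) •
    (lp.singleContinuousLinearMap ℂ (fun _ : Fin M → ℕ => H) 2 n ∘L X
      ∘L lp.evalCLM ℂ (fun _ : Fin M → ℕ => H) 2 n)

/-- `ρ_th(N)^{⊗M}` on the `M`-mode Fock space. -/
def thermalState (M : ℕ) (N : ℝ) : Modes M ℂ →L[ℂ] Modes M ℂ :=
  tensorThermal M N (1 : ℂ →L[ℂ] ℂ)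

/-- Partial trace over the `M` bosonic modes, `X ↦ ∑ₙ ⟨n|X|n⟩`. -/
def traceModes (X : Modes M H →L[ℂ] Modes M H) : H →L[ℂ] H :=
  ∑' n : Fin M → ℕ, lp.evalCLM ℂ (fun _ : Fin M → ℕ => H) 2 n ∘L X
    ∘L lp.singleContinuousLinearMap ℂ (fun _ : Fin M → ℕ => H) 2 n

/-- An index set of an orthonormal (Hilbert) basis of `H`. -/
def basisSet (H : Type*) [NormedAddCommGroup H] [InnerProductSpace ℂ H] [CompleteSpace H] :
    Set H :=
  (exists_hilbertBasis ℂ H).choose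

/-- An orthonormal (Hilbert) basis of `H`. -/
def onb (H : Type*) [NormedAddCommGroup H] [InnerProductSpace ℂ H] [CompleteSpace H] :
    HilbertBasis (basisSet H) ℂ H :=
  (exists_hilbertBasis ℂ H).choose_spec.choose

/-- `⟨h| ⊗ 1 : H ⊗ (Fock space) → Fock space`. -/
def braH (h : H) : Modes M H →L[ℂ] Modes M ℂ :=
  lp.mapCLM 2 (fun _ : Fin M → ℕ => innerSL ℂ h) (norm_nonneg h)
    (fun _ => (innerSL_apply_norm (𝕜 := ℂ) h).le)

open ContinuousLinearMap in
/-- Partial trace over the auxiliary system, `X ↦ ∑_b ⟨b|X|b⟩` over an orthonormal basis of `H`. -/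
def traceAux (X : Modes M H →L[ℂ] Modes M H) : Modes M ℂ →L[ℂ] Modes M ℂ :=
  ∑' i : basisSet H, braH (onb H i) ∘L X ∘L adjoint (braH (onb H i))

/-! ### Trace norm and discrimination error -/

/-- The trace norm `‖X‖₁ = Tr √(X† X)`, as an extended nonnegative real. -/
def traceNorm (X : H →L[ℂ] H) : ℝ≥0∞ :=
  ∑' i : basisSet H, ENNReal.ofReal (RCLike.re ⟪onb H i, CFC.abs X (onb H i)⟫_ℂ)

/-- Least average error probability for discriminating two equally likely states,
`1/2 - ‖ρ₀ - ρ₁‖₁ / 4`. -/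
def errorProb (ρ₀ ρ₁ : H →L[ℂ] H) : ℝ :=
  1 / 2 - (traceNorm (ρ₀ - ρ₁)).toReal / 4

/-! ### Probes and the two hypothesis tests -/

/-- Data of a probe `∑ₙ √(pₙ) |χₙ⟩_I |n⟩_S` with `M` signal modes and idler space `I`: a
probability distribution `p` on `ℕᴹ` and unit vectors `χₙ` (not necessarily orthogonal). -/
structure Probe (M : ℕ) (I : Type*) [NormedAddCommGroup I] where
  p : (Fin M → ℕ) → ℝ
  χ : (Fin M → ℕ) → I
  p_nonneg : ∀ n, 0 ≤ p n
  p_sum : HasSum p 1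
  χ_norm : ∀ n, ‖χ n‖ = 1

namespace Probe

variable {I : Type*} [NormedAddCommGroup I] [InnerProductSpace ℂ I]

/-- The vector `∑ₙ √(pₙ) |χₙ⟩_I |n⟩_S`. -/
def ket (P : Probe M I) : Modes M I :=
  ⟨fun n => ((√(P.p n) : ℝ) : ℂ) • P.χ n, memℓp_gen (by
    refine P.p_sum.summable.congr fun n => ?_
    rw [norm_smul, P.χ_norm, mul_one, Complex.norm_real, Real.norm_eq_abs,
      abs_of_nonneg (Real.sqrt_nonneg _), ENNReal.toReal_ofNat, Real.rpow_ofNat,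
      Real.sq_sqrt (P.p_nonneg n)])⟩

/-- The density operator `Ψ = |ψ⟩⟨ψ|`. -/
def density (P : Probe M I) : Modes M I →L[ℂ] Modes M I :=
  InnerProductSpace.rankOne ℂ P.ket P.ket

variable [CompleteSpace I]

/-- Alice's state when the target is absent, `(Tr_S Ψ) ⊗ ρ_th(N_B)^{⊗M}`. -/
def aliceAbsent (P : Probe M I) (N_B : ℝ) : Modes M I →L[ℂ] Modes M I :=
  tensorThermal M N_B (traceModes P.density)

/-- Alice's state when the target is present, `(id_I ⊗ L_{η,N_B}^{⊗M}) Ψ`. -/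
def alicePresent (P : Probe M I) (η : unitInterval) (N_B : ℝ) : Modes M I →L[ℂ] Modes M I :=
  thermalLoss η N_B P.density

/-- Willie's state when Alice has sent the probe, `L_{1-η,N_B}^{⊗M} (Tr_I Ψ)`. -/
def willieProbed (P : Probe M I) (η : unitInterval) (N_B : ℝ) : Modes M ℂ →L[ℂ] Modes M ℂ :=
  thermalLoss (unitInterval.symm η) N_B (traceAux P.density)

/-- Alice's error probability `P_e^A`. -/
def aliceError (P : Probe M I) (η : unitInterval) (N_B : ℝ) : ℝ :=
  errorProb (P.aliceAbsent N_B) (P.alicePresent η N_B)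

/-- Willie's error probability `P_e^W`; his null-hypothesis state is `ρ_th(N_B)^{⊗M}`. -/
def willieError (P : Probe M I) (η : unitInterval) (N_B : ℝ) : ℝ :=
  errorProb (thermalState M N_B) (P.willieProbed η N_B)

/-- `ε`-covertness. -/
def IsCovert (P : Probe M I) (η : unitInterval) (N_B ε : ℝ) : Prop :=
  1 / 2 - ε ≤ P.willieError η N_B

end Probe

/-! ### The constants of the bound -/

/-- `Θ = √((1-η)(N_B+1)) / √(1+(1-η)N_B)`. -/
def Theta (η N_B : ℝ) : ℝ :=
  √((1 - η) * (N_B + 1)) / √(1 + (1 - η) * N_B)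

/-- `1 - η [1 + N_B (1 - Θ)]`, the denominator in `x`. -/
def xDenom (η N_B : ℝ) : ℝ :=
  1 - η * (1 + N_B * (1 - Theta η N_B))

/-- `x = 1 - (1 - Θ) / (1 - η [1 + N_B (1 - Θ)])`, the solution of
`1 + (x - 1)(1 - η) / (η N_B (1 - x) + 1) = Θ`. -/
def xVal (η N_B : ℝ) : ℝ :=
  1 - (1 - Theta η N_B) / xDenom η N_B

/-- `ν = (√(G₀ G₁) - √((G₀ - 1)(G₁ - 1)))⁻¹` with `G₀ = N_B + 1`, `G₁ = (1 - η) N_B + 1`. -/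
def nu (η N_B : ℝ) : ℝ :=
  (√((N_B + 1) * ((1 - η) * N_B + 1))
    - √((N_B + 1 - 1) * ((1 - η) * N_B + 1 - 1)))⁻¹

/-- `f = ν (N_B + 1 - N_B / x) [η N_B (1 - x) + 1]`. -/
def fVal (η N_B : ℝ) : ℝ :=
  nu η N_B * (N_B + 1 - N_B / xVal η N_B) * (η * N_B * (1 - xVal η N_B) + 1)

/-- The convergence condition on `x`: it is well defined and `N_B / (N_B + 1) ≤ x ≤ 1`. -/
def ConvergenceCondition (η N_B : ℝ) : Prop :=
  xDenom η N_B ≠ 0 ∧ N_B / (N_B + 1) ≤ xVal η N_B ∧ xVal η N_B ≤ 1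

end CovertQI

end

/-!
Thermal loss is pure loss followed by quantum-limited amplification, so that `ρ₀` and `ρ₁` are both
ensembles indexed by the numbers of gained and lost photons: the two single-mode kernels satisfy
the same recursion, which determines them. For a probe with photon-number distribution `p`, the two
ensembles have overlap `ν ^ M * ∑ₙ pₙ Θ ^ |n|`, and Uhlmann's theorem together with the inequality
of Fuchs and van de Graaf turns this into a lower bound on Alice's error probability.

It remains to bound `∑ₙ pₙ Θ ^ |n|` from below. Let `P₀` and `P₁` be Willie's photon-number
distributions under the two hypotheses. Covertness bounds the total variation distance, whence
`1 - 2 ε ≤ ∑ⱼ √(P₀ j * P₁ j)`. Splitting the summand as `√(P₀ j * x⁻¹ ^ |j|) * √(P₁ j * x ^ |j|)`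
and applying the Cauchy–Schwarz inequality bounds `(1 - 2 ε) ^ 2` by a product of two probability
generating functions. The first is an explicit geometric series, and `x` is chosen so that the
second is an explicit factor times `∑ₙ pₙ Θ ^ |n|`.
-/

noncomputable section

namespace CovertQI

/-! ### The trace norm -/

section TraceNorm

open InnerProductSpace

variable {K : Type*} [NormedAddCommGroup K] [InnerProductSpace ℂ K]

lemma norm_sum_inner_mul_inner_le {ι : Type*} {v : ι → K} (hv : Orthonormal ℂ v) (F : Finset ι)
    (x y : K) : ‖∑ i ∈ F, ⟪x, v i⟫_ℂ * ⟪v i, y⟫_ℂ‖ ≤ ‖x‖ * ‖y‖ := by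
  calc ‖∑ i ∈ F, ⟪x, v i⟫_ℂ * ⟪v i, y⟫_ℂ‖ ≤ ∑ i ∈ F, ‖⟪v i, x⟫_ℂ‖ * ‖⟪v i, y⟫_ℂ‖ := by
        refine (norm_sum_le _ _).trans_eq (Finset.sum_congr rfl fun i _ => ?_)
        rw [norm_mul, norm_inner_symm]
    _ ≤ √(∑ i ∈ F, ‖⟪v i, x⟫_ℂ‖ ^ 2) * √(∑ i ∈ F, ‖⟪v i, y⟫_ℂ‖ ^ 2) :=
        Real.sum_mul_le_sqrt_mul_sqrt _ _ _
    _ ≤ √(‖x‖ ^ 2) * √(‖y‖ ^ 2) := by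
        gcongr
        · exact hv.sum_inner_products_le x
        · exact hv.sum_inner_products_le y
    _ = ‖x‖ * ‖y‖ := by simp

lemma norm_sum_inner_rankOne_le {ι : Type*} {v : ι → K} (hv : Orthonormal ℂ v) (F : Finset ι)
    {S : K →L[ℂ] K} (hS : ‖S‖ ≤ 1) (x y : K) :
    ‖∑ i ∈ F, ⟪v i, S (rankOne ℂ x y (v i))⟫_ℂ‖ ≤ ‖x‖ * ‖y‖ := by
  calc ‖∑ i ∈ F, ⟪v i, S (rankOne ℂ x y (v i))⟫_ℂ‖
      = ‖∑ i ∈ F, ⟪y, v i⟫_ℂ * ⟪v i, S x⟫_ℂ‖ := by simp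
    _ ≤ ‖y‖ * ‖S x‖ := norm_sum_inner_mul_inner_le hv F _ _
    _ ≤ ‖y‖ * ‖x‖ := by gcongr; simpa using S.le_of_opNorm_le hS x
    _ = ‖x‖ * ‖y‖ := mul_comm _ _

lemma rankOne_self_sub_rankOne_self (x y : K) :
    rankOne ℂ x x - rankOne ℂ y y
      = (2⁻¹ : ℂ) • (rankOne ℂ (x + y) (x - y) + rankOne ℂ (x - y) (x + y)) := by
  ext z
  simp only [map_add, map_sub, add_apply, sub_apply, smul_apply, rankOne_apply]
  module

lemma norm_sum_inner_rankOne_sub_rankOne_le {ι : Type*} {v : ι → K} (hv : Orthonormal ℂ v)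
    (F : Finset ι) {S : K →L[ℂ] K} (hS : ‖S‖ ≤ 1) (x y : K) :
    ‖∑ i ∈ F, ⟪v i, S ((rankOne ℂ x x - rankOne ℂ y y) (v i))⟫_ℂ‖ ≤ ‖x + y‖ * ‖x - y‖ := by
  have hsum : ∑ i ∈ F, ⟪v i, S ((rankOne ℂ x x - rankOne ℂ y y) (v i))⟫_ℂ
      = 2⁻¹ * (∑ i ∈ F, ⟪v i, S (rankOne ℂ (x + y) (x - y) (v i))⟫_ℂ
          + ∑ i ∈ F, ⟪v i, S (rankOne ℂ (x - y) (x + y) (v i))⟫_ℂ) := by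
    rw [rankOne_self_sub_rankOne_self, ← Finset.sum_add_distrib, Finset.mul_sum]
    refine Finset.sum_congr rfl fun i _ => ?_
    rw [smul_apply, map_smul, inner_smul_right, add_apply, map_add, inner_add_right]
  have h₁ := norm_sum_inner_rankOne_le hv F hS (x + y) (x - y)
  have h₂ := norm_sum_inner_rankOne_le hv F hS (x - y) (x + y)
  rw [hsum, norm_mul, norm_inv, RCLike.norm_ofNat]
  linarith [norm_add_le (∑ i ∈ F, ⟪v i, S (rankOne ℂ (x + y) (x - y) (v i))⟫_ℂ)
    (∑ i ∈ F, ⟪v i, S (rankOne ℂ (x - y) (x + y) (v i))⟫_ℂ)]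

lemma hasSum_norm_sq_inner {ι : Type*} (v : HilbertBasis ι ℂ K) (x : K) :
    HasSum (fun i => ‖⟪v i, x⟫_ℂ‖ ^ 2) (‖x‖ ^ 2) := by
  have h := RCLike.hasSum_re ℂ (v.hasSum_inner_mul_inner x x)
  rw [inner_self_eq_norm_sq (𝕜 := ℂ)] at h
  refine h.congr_fun fun i => ?_
  rw [← inner_conj_symm x, RCLike.conj_mul]
  norm_cast

variable [CompleteSpace K]

lemma continuous_inv_abs_add {δ : ℝ} (hδ : 0 < δ) : Continuous fun t : ℝ => (|t| + δ)⁻¹ :=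
  (continuous_abs.add continuous_const).inv₀ fun t =>
    (add_pos_of_nonneg_of_pos (abs_nonneg t) hδ).ne'

lemma norm_cfc_inv_abs_add_mul_self_le {A : K →L[ℂ] K} (hA : IsSelfAdjoint A) {δ : ℝ}
    (hδ : 0 < δ) : ‖cfc (fun t : ℝ => (|t| + δ)⁻¹) A * A‖ ≤ 1 := by
  have hpos : ∀ t : ℝ, 0 < |t| + δ := fun t => by positivity
  have h : cfc (fun t : ℝ => (|t| + δ)⁻¹) A * A = cfc (fun t : ℝ => (|t| + δ)⁻¹ * t) A := by
    rw [cfc_mul _ _ A (continuous_inv_abs_add hδ).continuousOn (by fun_prop), cfc_id' ℝ A]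
  rw [h]
  refine norm_cfc_le zero_le_one fun t _ => ?_
  rw [norm_mul, norm_inv, Real.norm_eq_abs, Real.norm_eq_abs, abs_of_pos (hpos t), inv_mul_eq_div,
    div_le_one (hpos t)]
  linarith

lemma norm_sub_cfc_inv_abs_add_mul_le {A : K →L[ℂ] K} (hA : 0 ≤ A) {δ : ℝ} (hδ : 0 < δ) :
    ‖A - cfc (fun t : ℝ => (|t| + δ)⁻¹) A * (A * A)‖ ≤ δ := by
  have hsa : IsSelfAdjoint A := hA.isSelfAdjoint
  have hg : ContinuousOn (fun t : ℝ => (|t| + δ)⁻¹) (spectrum ℝ A) :=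
    (continuous_inv_abs_add hδ).continuousOn
  have h : A - cfc (fun t : ℝ => (|t| + δ)⁻¹) A * (A * A)
      = cfc (fun t : ℝ => t - (|t| + δ)⁻¹ * (t * t)) A := by
    rw [cfc_sub _ _ A (by fun_prop) (by fun_prop), cfc_mul _ _ A hg (by fun_prop),
      cfc_mul _ _ A (by fun_prop) (by fun_prop), cfc_id' ℝ A]
  rw [h]
  refine norm_cfc_le hδ.le fun t ht => ?_
  have ht₀ : 0 ≤ t := spectrum_nonneg_of_nonneg hA ht
  have hvalue : t - (|t| + δ)⁻¹ * (t * t) = δ * (t / (t + δ)) := by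
    rw [abs_of_nonneg ht₀]
    field
  rw [hvalue, Real.norm_of_nonneg (by positivity)]
  exact mul_le_of_le_one_right hδ.le ((div_le_one (by positivity)).mpr (by linarith))

lemma exists_contraction_norm_abs_sub_mul_le (X : K →L[ℂ] K) {δ : ℝ} (hδ : 0 < δ) :
    ∃ S : K →L[ℂ] K, ‖S‖ ≤ 1 ∧ ‖CFC.abs X - S * X‖ ≤ δ := by
  -- `S = (|X| + δ)⁻¹ X†` regularises the adjoint of the partial isometry of `X`.
  set A := CFC.abs X
  have hA : IsSelfAdjoint A := (CFC.abs_nonneg X).isSelfAdjoint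
  set G := cfc (fun t : ℝ => (|t| + δ)⁻¹) A
  have hG : star G = G := IsSelfAdjoint.star_eq (cfc_predicate _ A)
  have hXX : star X * X = A * A := (CFC.abs_mul_abs X).symm
  refine ⟨G * star X, ?_, ?_⟩
  · have h : ‖G * star X‖ * ‖G * star X‖ = ‖G * A‖ * ‖G * A‖ := by
      rw [← CStarRing.norm_self_mul_star, ← CStarRing.norm_self_mul_star]
      simp only [star_mul, star_star, hG, hA.star_eq, mul_assoc]
      rw [← mul_assoc (star X), hXX, mul_assoc]
    rw [(mul_self_inj (norm_nonneg _) (norm_nonneg _)).mp h]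
    exact norm_cfc_inv_abs_add_mul_self_le hA hδ
  · rw [mul_assoc, hXX]
    exact norm_sub_cfc_inv_abs_add_mul_le (CFC.abs_nonneg X) hδ

lemma re_inner_abs_nonneg (X : K →L[ℂ] K) (x : K) : 0 ≤ RCLike.re ⟪x, CFC.abs X x⟫_ℂ :=
  ((ContinuousLinearMap.nonneg_iff_isPositive _).mp (CFC.abs_nonneg X)).re_inner_nonneg_right x

lemma traceNorm_le_of_norm_sum_inner_le {X : K →L[ℂ] K} {C : ℝ}
    (hC : ∀ S : K →L[ℂ] K, ‖S‖ ≤ 1 → ∀ F : Finset (basisSet K),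
      ‖∑ i ∈ F, ⟪onb K i, S (X (onb K i))⟫_ℂ‖ ≤ C) :
    traceNorm X ≤ ENNReal.ofReal C := by
  rw [traceNorm, ENNReal.tsum_eq_iSup_sum]
  refine iSup_le fun F => ?_
  rw [← ENNReal.ofReal_sum_of_nonneg fun i _ => re_inner_abs_nonneg X _]
  refine ENNReal.ofReal_le_ofReal (le_of_forall_pos_le_add fun ε hε => ?_)
  set δ := ε / (F.card + 1) with hδ
  obtain ⟨S, hS, hSX⟩ := exists_contraction_norm_abs_sub_mul_le X (δ := δ) (by positivity)
  have hclose : ∀ i, RCLike.re ⟪onb K i, CFC.abs X (onb K i)⟫_ℂ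
      ≤ RCLike.re ⟪onb K i, S (X (onb K i))⟫_ℂ + δ := by
    intro i
    have hi : ‖onb K i‖ = 1 := (onb K).orthonormal.1 i
    have h := ((RCLike.re_le_norm _).trans
      (norm_inner_le_norm (𝕜 := ℂ) (onb K i) ((CFC.abs X - S * X) (onb K i)))).trans
      (mul_le_mul_of_nonneg_left ((CFC.abs X - S * X).le_of_opNorm_le hSX _) (norm_nonneg _))
    rw [sub_apply, inner_sub_right, map_sub, hi, one_mul, mul_one,
      mul_apply_eq_comp] at h
    linarith
  have hcard : F.card * δ ≤ ε := by
    rw [hδ, mul_div_assoc', div_le_iff₀ (by positivity)]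
    linarith
  calc ∑ i ∈ F, RCLike.re ⟪onb K i, CFC.abs X (onb K i)⟫_ℂ
      ≤ ∑ i ∈ F, (RCLike.re ⟪onb K i, S (X (onb K i))⟫_ℂ + δ) :=
        Finset.sum_le_sum fun i _ => hclose i
    _ = RCLike.re (∑ i ∈ F, ⟪onb K i, S (X (onb K i))⟫_ℂ) + F.card * δ := by
        rw [Finset.sum_add_distrib, map_sum, Finset.sum_const, nsmul_eq_mul]
    _ ≤ C + ε := add_le_add ((RCLike.re_le_norm _).trans (hC S hS F)) hcard

lemma norm_inner_self_le_re_inner_abs {X : K →L[ℂ] K} (hX : IsSelfAdjoint X) (x : K) :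
    ‖⟪x, X x⟫_ℂ‖ ≤ RCLike.re ⟪x, CFC.abs X x⟫_ℂ := by
  have hp := ((ContinuousLinearMap.nonneg_iff_isPositive _).mp
    (CFC.posPart_nonneg X)).re_inner_nonneg_right x
  have hm := ((ContinuousLinearMap.nonneg_iff_isPositive _).mp
    (CFC.negPart_nonneg X)).re_inner_nonneg_right x
  have hre : ((RCLike.re ⟪x, X x⟫_ℂ : ℝ) : ℂ) = ⟪x, X x⟫_ℂ :=
    (ContinuousLinearMap.isSelfAdjoint_iff_isSymmetric.mp hX).coe_re_inner_self_apply x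
  rw [← hre, Complex.norm_real, Real.norm_eq_abs, ← CFC.posPart_add_negPart X hX]
  conv_lhs => rw [← CFC.posPart_sub_negPart X hX]
  rw [sub_apply, add_apply, inner_sub_right, inner_add_right, map_sub, map_add, abs_le]
  constructor <;> linarith

lemma tsum_norm_inner_le_traceNorm {ι : Type*} {v : ι → K} (hv : Orthonormal ℂ v)
    {X : K →L[ℂ] K} (hX : IsSelfAdjoint X) :
    ∑' i, ENNReal.ofReal ‖⟪v i, X (v i)⟫_ℂ‖ ≤ traceNorm X := by
  set R := CFC.sqrt (CFC.abs X)
  have hsymm : R.IsSymmetric := ContinuousLinearMap.isSelfAdjoint_iff_isSymmetric.mp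
    (CFC.sqrt_nonneg (CFC.abs X)).isSelfAdjoint
  have hRR : R * R = CFC.abs X := CFC.sqrt_mul_sqrt_self _ (CFC.abs_nonneg X)
  have hnorm : ∀ x, RCLike.re ⟪x, CFC.abs X x⟫_ℂ = ‖R x‖ ^ 2 := fun x => by
    rw [← hRR, mul_apply_eq_comp, ← inner_self_eq_norm_sq (𝕜 := ℂ) (R x)]
    exact congrArg _ (hsymm x (R x)).symm
  calc ∑' i, ENNReal.ofReal ‖⟪v i, X (v i)⟫_ℂ‖
      ≤ ∑' i, ENNReal.ofReal (‖R (v i)‖ ^ 2) := by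
        refine ENNReal.tsum_le_tsum fun i => ENNReal.ofReal_le_ofReal ?_
        exact (norm_inner_self_le_re_inner_abs hX _).trans_eq (hnorm _)
    _ = ∑' i, ∑' b, ENNReal.ofReal (‖⟪v i, R (onb K b)⟫_ℂ‖ ^ 2) := by
        refine tsum_congr fun i => ?_
        have h := hasSum_norm_sq_inner (onb K) (R (v i))
        rw [← h.tsum_eq, ENNReal.ofReal_tsum_of_nonneg (fun _ => by positivity) h.summable]
        refine tsum_congr fun b => ?_
        rw [norm_inner_symm]
        exact congrArg (fun z : ℂ => ENNReal.ofReal (‖z‖ ^ 2)) (hsymm _ _)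
    _ = ∑' b, ∑' i, ENNReal.ofReal (‖⟪v i, R (onb K b)⟫_ℂ‖ ^ 2) := ENNReal.tsum_comm
    _ ≤ ∑' b, ENNReal.ofReal (‖R (onb K b)‖ ^ 2) := by
        refine ENNReal.tsum_le_tsum fun b => ?_
        rw [← ENNReal.ofReal_tsum_of_nonneg (fun _ => by positivity)
          (hv.inner_products_summable _)]
        exact ENNReal.ofReal_le_ofReal (hv.tsum_inner_products_le _)
    _ = traceNorm X := by simp_rw [traceNorm, hnorm]

end TraceNorm

/-! ### Ensembles -/

section Ensemble

open InnerProductSpace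

variable {E K : Type*} [NormedAddCommGroup K] [InnerProductSpace ℂ K]

/-- The unnormalised vectors `v e` form an ensemble of the density operator `ρ`, that is
`ρ = ∑ₑ |v e⟩⟨v e|` with total weight `∑ₑ ‖v e‖² = 1`. -/
structure IsEnsemble (v : E → K) (ρ : K →L[ℂ] K) : Prop where
  hasSum_norm_sq : HasSum (fun e => ‖v e‖ ^ 2) 1
  hasSum_rankOne : HasSum (fun e => rankOne ℂ (v e) (v e)) ρ

namespace IsEnsemble

variable {u v : E → K} {ρ σ : K →L[ℂ] K}

lemma hasSum_inner (h : IsEnsemble v ρ) (S : K →L[ℂ] K) (x y : K) :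
    HasSum (fun e => ⟪x, S (rankOne ℂ (v e) (v e) y)⟫_ℂ) ⟪x, S (ρ y)⟫_ℂ :=
  h.hasSum_rankOne.mapL ((innerSL ℂ x ∘L S) ∘L ContinuousLinearMap.apply ℂ K y)

lemma summable_and_tsum_norm_add_mul_norm_sub_le (hu : IsEnsemble u ρ) (hv : IsEnsemble v σ) {c : ℝ}
    (hc : HasSum (fun e => RCLike.re ⟪u e, v e⟫_ℂ) c) :
    Summable (fun e => ‖u e + v e‖ * ‖u e - v e‖) ∧
      ∑' e, ‖u e + v e‖ * ‖u e - v e‖ ≤ 2 * √(1 - c ^ 2) := by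
  have hadd : HasSum (fun e => ‖u e + v e‖ ^ 2) (2 + 2 * c) := by
    have h := ((hu.hasSum_norm_sq.add (hc.mul_left 2)).add hv.hasSum_norm_sq).congr_fun
      fun e => norm_add_sq (𝕜 := ℂ) (u e) (v e)
    rwa [show 1 + 2 * c + 1 = 2 + 2 * c by ring] at h
  have hsub : HasSum (fun e => ‖u e - v e‖ ^ 2) (2 - 2 * c) := by
    have h := ((hu.hasSum_norm_sq.sub (hc.mul_left 2)).add hv.hasSum_norm_sq).congr_fun
      fun e => norm_sub_sq (𝕜 := ℂ) (u e) (v e)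
    rwa [show 1 - 2 * c + 1 = 2 - 2 * c by ring] at h
  obtain ⟨hsummable, hle⟩ := Real.summable_and_inner_le_Lp_mul_Lq_tsum_of_nonneg
    (f := fun e => ‖u e + v e‖) (g := fun e => ‖u e - v e‖) Real.HolderConjugate.two_two
    (fun _ => norm_nonneg _) (fun _ => norm_nonneg _)
    (by simpa using hadd.summable) (by simpa using hsub.summable)
  refine ⟨hsummable, hle.trans_eq ?_⟩
  simp only [Real.rpow_ofNat, hadd.tsum_eq, hsub.tsum_eq, ← Real.sqrt_eq_rpow]
  have hnonneg : 0 ≤ 2 + 2 * c := hadd.nonneg fun _ => by positivity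
  rw [← Real.sqrt_mul hnonneg, show (2 + 2 * c) * (2 - 2 * c) = 2 ^ 2 * (1 - c ^ 2) by ring,
    Real.sqrt_mul (by norm_num), Real.sqrt_sq (by norm_num)]

variable [CompleteSpace K]

lemma of_hasSum_norm_sq (hv : HasSum (fun e => ‖v e‖ ^ 2) 1)
    (hρ : ρ = ∑' e, rankOne ℂ (v e) (v e)) : IsEnsemble v ρ where
  hasSum_norm_sq := hv
  hasSum_rankOne := by
    rw [hρ]
    exact (Summable.of_norm (by simpa [← sq] using hv.summable)).hasSum

lemma isSelfAdjoint (h : IsEnsemble v ρ) : IsSelfAdjoint ρ := by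
  have hstar := h.hasSum_rankOne.star
  simp_rw [((isPositive_rankOne_self _).isSelfAdjoint).star_eq] at hstar
  exact hstar.unique h.hasSum_rankOne

lemma norm_sum_inner_le_one (h : IsEnsemble v ρ) {S : K →L[ℂ] K} (hS : ‖S‖ ≤ 1)
    (F : Finset (basisSet K)) : ‖∑ i ∈ F, ⟪onb K i, S (ρ (onb K i))⟫_ℂ‖ ≤ 1 := by
  rw [← (hasSum_sum fun i (_ : i ∈ F) => h.hasSum_inner S (onb K i) (onb K i)).tsum_eq]
  refine tsum_of_norm_bounded h.hasSum_norm_sq fun e => ?_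
  exact (norm_sum_inner_rankOne_le (onb K).orthonormal F hS _ _).trans_eq (sq _).symm

lemma traceNorm_sub_ne_top {E' : Type*} {w : E' → K} (h : IsEnsemble v ρ) (h' : IsEnsemble w σ) :
    traceNorm (ρ - σ) ≠ ⊤ := by
  refine ne_top_of_le_ne_top ENNReal.ofReal_ne_top (b := ENNReal.ofReal (1 + 1)) ?_
  refine traceNorm_le_of_norm_sum_inner_le fun S hS F => ?_
  simp only [sub_apply, map_sub, inner_sub_right, Finset.sum_sub_distrib]
  exact (norm_sub_le _ _).trans
    (add_le_add (h.norm_sum_inner_le_one hS F) (h'.norm_sum_inner_le_one hS F))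

/-- Uhlmann's bound: two ensembles with a common index set give purifications
`∑ₑ |e⟩ ⊗ |u e⟩` and `∑ₑ |e⟩ ⊗ |v e⟩` of overlap `c`. -/
lemma traceNorm_sub_le (hu : IsEnsemble u ρ) (hv : IsEnsemble v σ) {c : ℝ}
    (hc : HasSum (fun e => RCLike.re ⟪u e, v e⟫_ℂ) c) :
    traceNorm (ρ - σ) ≤ ENNReal.ofReal (2 * √(1 - c ^ 2)) := by
  obtain ⟨hsummable, hle⟩ := hu.summable_and_tsum_norm_add_mul_norm_sub_le hv hc
  refine traceNorm_le_of_norm_sum_inner_le fun S hS F => le_trans ?_ hle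
  have h := hasSum_sum fun i (_ : i ∈ F) =>
    (hu.hasSum_inner S (onb K i) (onb K i)).sub (hv.hasSum_inner S (onb K i) (onb K i))
  simp only [← inner_sub_right, ← map_sub, ← sub_apply] at h
  rw [← h.tsum_eq]
  exact tsum_of_norm_bounded hsummable.hasSum fun e =>
    norm_sum_inner_rankOne_sub_rankOne_le (onb K).orthonormal F hS _ _

end IsEnsemble

end Ensemble

/-! ### Beam-splitter coefficients -/

/-- The sequence `0, f 0, f 1, …`. -/
def delay (f : ℕ → ℝ) : ℕ → ℝ
  | 0 => 0
  | j + 1 => f j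

@[simp] lemma delay_zero (f : ℕ → ℝ) : delay f 0 = 0 := rfl

@[simp] lemma delay_succ (f : ℕ → ℝ) (j : ℕ) : delay f (j + 1) = f j := rfl

lemma hasSum_delay_apply {E : Type*} {f : ℕ → E → ℝ} {a : ℕ → ℝ} (h : ∀ i, HasSum (f i) (a i))
    (j : ℕ) : HasSum (fun e => delay (fun i => f i e) j) (delay a j) := by
  cases j with
  | zero => exact hasSum_zero
  | succ j => exact h j

lemma hasSum_delay_fst_iff {f : ℕ × ℕ → ℝ} {a : ℝ} :
    HasSum (fun e : ℕ × ℕ => delay (fun m => f (m, e.2)) e.1) a ↔ HasSum f a := by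
  have hinj : Function.Injective fun e : ℕ × ℕ => (e.1 + 1, e.2) := by
    rintro ⟨m, k⟩ ⟨m', k'⟩ h
    simpa using h
  refine (hinj.hasSum_iff ?_).symm
  rintro ⟨_ | m, k⟩ hmk
  · rfl
  · exact absurd ⟨(m, k), rfl⟩ hmk

lemma hasSum_delay_snd_iff {f : ℕ × ℕ → ℝ} {a : ℝ} :
    HasSum (fun e : ℕ × ℕ => delay (fun k => f (e.1, k)) e.2) a ↔ HasSum f a := by
  have hinj : Function.Injective fun e : ℕ × ℕ => (e.1, e.2 + 1) := by
    rintro ⟨m, k⟩ ⟨m', k'⟩ h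
    simpa using h
  refine (hinj.hasSum_iff ?_).symm
  rintro ⟨m, _ | k⟩ hmk
  · rfl
  · exact absurd ⟨(m, k), rfl⟩ hmk

section Coefficients

open MvPolynomial

/-- The coefficient of the monomial `xʲ yᵏ`, with `x = X 0` and `y = X 1`. -/
def coeffXY (f : MvPolynomial (Fin 2) ℝ) (j k : ℕ) : ℝ :=
  f.coeff (Finsupp.single 0 j + Finsupp.single 1 k)

lemma coeffXY_add (f g : MvPolynomial (Fin 2) ℝ) (j k : ℕ) :
    coeffXY (f + g) j k = coeffXY f j k + coeffXY g j k := coeff_add ..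

lemma coeffXY_sub (f g : MvPolynomial (Fin 2) ℝ) (j k : ℕ) :
    coeffXY (f - g) j k = coeffXY f j k - coeffXY g j k := coeff_sub ..

lemma coeffXY_C_mul (c : ℝ) (f : MvPolynomial (Fin 2) ℝ) (j k : ℕ) :
    coeffXY (C c * f) j k = c * coeffXY f j k := coeff_C_mul ..

lemma coeffXY_X_zero_mul (f : MvPolynomial (Fin 2) ℝ) (j k : ℕ) :
    coeffXY (X 0 * f) j k = delay (fun i => coeffXY f i k) j := by
  cases j with
  | zero => simp [coeffXY, coeff_X_mul']
  | succ j =>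
    rw [coeffXY, add_comm j 1, Finsupp.single_add, add_assoc, coeff_X_mul, add_comm 1 j]
    rfl

lemma coeffXY_X_one_mul (f : MvPolynomial (Fin 2) ℝ) (j k : ℕ) :
    coeffXY (X 1 * f) j k = delay (coeffXY f j) k := by
  cases k with
  | zero => simp [coeffXY, coeff_X_mul']
  | succ k =>
    rw [coeffXY, add_comm k 1, Finsupp.single_add, add_left_comm, coeff_X_mul, add_comm 1 k]
    rfl

lemma coeffXY_pderiv_one (f : MvPolynomial (Fin 2) ℝ) (j k : ℕ) :
    coeffXY (pderiv 1 f) j k = (k + 1) * coeffXY f j (k + 1) := by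
  rw [coeffXY, coeff_pderiv, coeffXY, add_assoc, ← Finsupp.single_add]
  simp [mul_comm]

/-- The coefficient of `xʲ yᵏ` in `bsPoly κ n m`: the beam-splitter amplitude `⟨j, k|U|n, m⟩` up to
the normalisation of the number states. -/
def bsCoeff (κ : unitInterval) (n m j k : ℕ) : ℝ :=
  coeffXY (bsPoly κ n m) j k

variable (κ : unitInterval)

lemma bsCoeff_succ_left (n m j k : ℕ) :
    bsCoeff κ (n + 1) m j k = √(κ : ℝ) * delay (fun i => bsCoeff κ n m i k) j
      + √(1 - (κ : ℝ)) * delay (bsCoeff κ n m j) k := by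
  have h : bsPoly κ (n + 1) m = C (√(κ : ℝ)) * (X 0 * bsPoly κ n m)
      + C (√(1 - (κ : ℝ))) * (X 1 * bsPoly κ n m) := by
    simp only [bsPoly]; ring
  simp only [bsCoeff, h, coeffXY_add, coeffXY_C_mul, coeffXY_X_zero_mul, coeffXY_X_one_mul]
  rfl

lemma bsCoeff_succ_right (n m j k : ℕ) :
    bsCoeff κ n (m + 1) j k = √(1 - (κ : ℝ)) * delay (fun i => bsCoeff κ n m i k) j
      - √(κ : ℝ) * delay (bsCoeff κ n m j) k := by
  have h : bsPoly κ n (m + 1) = C (√(1 - (κ : ℝ))) * (X 0 * bsPoly κ n m)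
      - C (√(κ : ℝ)) * (X 1 * bsPoly κ n m) := by
    simp only [bsPoly]; ring
  simp only [bsCoeff, h, coeffXY_sub, coeffXY_C_mul, coeffXY_X_zero_mul, coeffXY_X_one_mul]
  rfl

lemma succ_mul_bsCoeff_succ (n m j k : ℕ) :
    (k + 1) * bsCoeff κ n m j (k + 1) = √(1 - (κ : ℝ)) * (n * bsCoeff κ (n - 1) m j k)
      - √(κ : ℝ) * (m * bsCoeff κ n (m - 1) j k) := by
  have h : pderiv 1 (bsPoly κ n m) = C (√(1 - (κ : ℝ))) * (C (n : ℝ) * bsPoly κ (n - 1) m)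
      - C (√(κ : ℝ)) * (C (m : ℝ) * bsPoly κ n (m - 1)) := by
    simp only [bsPoly, Derivation.leibniz, Derivation.leibniz_pow, smul_eq_mul, nsmul_eq_mul,
      map_add, map_sub, pderiv_C, pderiv_X_self, map_natCast,
      pderiv_X_of_ne (show (0 : Fin 2) ≠ 1 by decide)]
    ring
  simp only [bsCoeff, ← coeffXY_pderiv_one, h, coeffXY_sub, coeffXY_C_mul]

lemma bsCoeff_eq_zero {n m j k : ℕ} (h : n + m ≠ j + k) : bsCoeff κ n m j k = 0 := by
  have hP : (bsPoly κ n m).IsHomogeneous (1 * n + 1 * m) :=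
    (((isHomogeneous_C_mul_X _ _).add (isHomogeneous_C_mul_X _ _)).pow n).mul
      (((isHomogeneous_C_mul_X _ _).sub (isHomogeneous_C_mul_X _ _)).pow m)
  refine hP.coeff_eq_zero ?_
  simp only [map_add, Finsupp.degree_single]
  omega

lemma bsCoeff_zero_add (j k : ℕ) :
    bsCoeff κ 0 (j + k) j k = (j + k).choose j * √(1 - (κ : ℝ)) ^ j * (-√(κ : ℝ)) ^ k := by
  match j, k with
  | 0, 0 => simp [bsCoeff, coeffXY, bsPoly]
  | j + 1, 0 =>
    have ih := bsCoeff_zero_add j 0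
    rw [add_zero, Nat.choose_self] at ih
    rw [add_zero, bsCoeff_succ_right, delay_succ, delay_zero, ih, Nat.choose_self]
    ring
  | 0, k + 1 =>
    have ih := bsCoeff_zero_add 0 k
    rw [zero_add, Nat.choose_zero_right] at ih
    rw [zero_add, bsCoeff_succ_right, delay_succ, delay_zero, ih, Nat.choose_zero_right]
    ring
  | j + 1, k + 1 =>
    rw [← add_assoc, bsCoeff_succ_right, delay_succ, delay_succ, bsCoeff_zero_add (j + 1) k,
      show j + 1 + k = j + (k + 1) by omega, bsCoeff_zero_add j (k + 1), Nat.choose_succ_succ]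
    push_cast
    ring

lemma bsAmp_eq (n m j k : ℕ) :
    bsAmp κ n m j k =
      √((j.factorial * k.factorial : ℝ) / (n.factorial * m.factorial)) * bsCoeff κ n m j k := rfl

lemma factorial_div_mul_sq_bsCoeff_le (n m j k : ℕ) :
    (k.factorial / m.factorial : ℝ) * bsCoeff κ n m j k ^ 2 ≤ n.factorial := by
  have h := abs_bsAmp_le_one κ n m j k
  rw [← sq_le_one_iff_abs_le_one, bsAmp_eq, mul_pow, Real.sq_sqrt (by positivity)] at h
  have hj : (1 : ℝ) ≤ j.factorial := by exact_mod_cast j.factorial_pos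
  calc (k.factorial / m.factorial : ℝ) * bsCoeff κ n m j k ^ 2
      ≤ j.factorial * ((k.factorial / m.factorial : ℝ) * bsCoeff κ n m j k ^ 2) :=
        le_mul_of_one_le_left (by positivity) hj
    _ = n.factorial * ((j.factorial * k.factorial : ℝ) / (n.factorial * m.factorial)
          * bsCoeff κ n m j k ^ 2) := by field
    _ ≤ n.factorial := mul_le_of_le_one_right (by positivity) h

lemma factorial_div_mul_abs_bsCoeff_mul_le (n n' m j j' k : ℕ) :
    (k.factorial / m.factorial : ℝ) * |bsCoeff κ n m j k * bsCoeff κ n' m j' k|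
      ≤ n.factorial + n'.factorial := by
  have hc := factorial_div_mul_sq_bsCoeff_le κ n m j k
  have hd := factorial_div_mul_sq_bsCoeff_le κ n' m j' k
  have hcd := mul_le_mul_of_nonneg_left
    (two_mul_le_add_sq |bsCoeff κ n m j k| |bsCoeff κ n' m j' k|)
    (by positivity : (0 : ℝ) ≤ k.factorial / m.factorial)
  rw [sq_abs, sq_abs, mul_assoc, ← abs_mul] at hcd
  have : 0 ≤ (k.factorial / m.factorial : ℝ) * |bsCoeff κ n m j k * bsCoeff κ n' m j' k| := by
    positivity
  linarith

lemma factorial_succ_div_mul_abs_bsCoeff_mul_le (n n' m j j' k : ℕ) :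
    ((k + 1).factorial / m.factorial : ℝ) * |bsCoeff κ n m j k * bsCoeff κ n' m j' (k + 1)|
      ≤ (k + 1) * n.factorial + n'.factorial := by
  have hc := mul_le_mul_of_nonneg_left (factorial_div_mul_sq_bsCoeff_le κ n m j k)
    (by positivity : (0 : ℝ) ≤ k + 1)
  rw [← mul_assoc, ← mul_div_assoc, ← Nat.cast_add_one, ← Nat.cast_mul, ← Nat.factorial_succ,
    Nat.cast_add_one] at hc
  have hd := factorial_div_mul_sq_bsCoeff_le κ n' m j' (k + 1)
  have hcd := mul_le_mul_of_nonneg_left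
    (two_mul_le_add_sq |bsCoeff κ n m j k| |bsCoeff κ n' m j' (k + 1)|)
    (by positivity : (0 : ℝ) ≤ (k + 1).factorial / m.factorial)
  rw [sq_abs, sq_abs, mul_assoc, ← abs_mul] at hcd
  have : 0 ≤ ((k + 1).factorial / m.factorial : ℝ)
      * |bsCoeff κ n m j k * bsCoeff κ n' m j' (k + 1)| := by positivity
  linarith

end Coefficients

/-! ### Thermal number distribution -/

/-- The number distribution of the single-mode thermal state with mean photon number `N`. -/
def thermalProb (N : ℝ) (m : ℕ) : ℝ := N ^ m / (N + 1) ^ (m + 1)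

section ThermalProb

variable {N : ℝ}

lemma thermalProb_nonneg (hN : 0 ≤ N) (m : ℕ) : 0 ≤ thermalProb N m := by
  unfold thermalProb; positivity

lemma thermalProb_eq (N : ℝ) (m : ℕ) : thermalProb N m = (N + 1)⁻¹ * (N / (N + 1)) ^ m := by
  rw [thermalProb, div_pow, pow_succ', div_mul_eq_div_div_swap, inv_mul_eq_div]

lemma thermalProb_succ (N : ℝ) (m : ℕ) :
    thermalProb N (m + 1) = N / (N + 1) * thermalProb N m := by
  rw [thermalProb_eq, thermalProb_eq, pow_succ]; ring

lemma div_add_one_lt_one (hN : 0 ≤ N) : N / (N + 1) < 1 := by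
  rw [div_lt_one (by positivity)]; linarith

lemma hasSum_thermalProb (hN : 0 ≤ N) : HasSum (thermalProb N) 1 := by
  have h := (hasSum_geometric_of_lt_one (by positivity) (div_add_one_lt_one hN)).mul_left
    (N + 1)⁻¹
  rw [show (N + 1)⁻¹ * (1 - N / (N + 1))⁻¹ = 1 by field_simp; simp] at h
  exact h.congr_fun (thermalProb_eq N)

lemma summable_thermalProb_mul_affine (hN : 0 ≤ N) (a b : ℝ) :
    Summable fun m : ℕ => thermalProb N m * (a + b * m) := by
  have hr : ‖N / (N + 1)‖ < 1 := by
    rw [Real.norm_of_nonneg (by positivity)]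
    exact div_add_one_lt_one hN
  have h := (summable_pow_mul_geometric_of_norm_lt_one 1 hr).mul_left ((N + 1)⁻¹ * b)
  refine (((hasSum_thermalProb hN).summable.mul_left a).add h).congr fun m => ?_
  rw [thermalProb_eq]
  ring

end ThermalProb

/-! ### The kernel of the thermal loss channel -/

section BeamSplitterKernel

variable (κ : unitInterval) (N : ℝ)

/-- The summand of `bsSum`, indexed by the photon numbers of the background input and of the
environment output. -/
def bsTerm (n n' j j' : ℕ) (e : ℕ × ℕ) : ℝ :=
  thermalProb N e.1 * (e.2.factorial / e.1.factorial)
    * bsCoeff κ n e.1 j e.2 * bsCoeff κ n' e.1 j' e.2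

/-- The kernel `⟨j|L(|n⟩⟨n'|)|j'⟩` of the single-mode thermal loss channel `L`, up to the
normalisation of the number states. -/
def bsSum (n n' j j' : ℕ) : ℝ := ∑' e, bsTerm κ N n n' j j' e

/-- The summand of `bsCrossSum`. -/
def bsCrossTerm (n n' j j' : ℕ) (e : ℕ × ℕ) : ℝ :=
  thermalProb N e.1 * ((e.2 + 1).factorial / e.1.factorial)
    * bsCoeff κ n e.1 j e.2 * bsCoeff κ n' e.1 j' (e.2 + 1)

/-- The variant of `bsSum` in which the environment output of the second factor holds one photon
more than that of the first; it is eliminated between two recursions to give the one for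
`bsSum`. -/
def bsCrossSum (n n' j j' : ℕ) : ℝ := ∑' e, bsCrossTerm κ N n n' j j' e

lemma bsSum_symm (n n' j j' : ℕ) : bsSum κ N n n' j j' = bsSum κ N n' n j' j :=
  tsum_congr fun e => by unfold bsTerm; ring

variable {N}

lemma summable_of_abs_le_thermalProb_mul (hN : 0 ≤ N) {f : ℕ × ℕ → ℝ} {n j : ℕ} {a b : ℝ}
    (hsupp : ∀ m k, n + m ≠ j + k → f (m, k) = 0)
    (hle : ∀ m k, k ≤ n + m → |f (m, k)| ≤ thermalProb N m * (a + b * m)) : Summable f := by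
  have hinj : Function.Injective fun m : ℕ => (m, n + m - j) := fun a b h => (Prod.ext_iff.mp h).1
  rw [← hinj.summable_iff]
  · exact Summable.of_norm_bounded (summable_thermalProb_mul_affine hN a b)
      fun m => hle m _ (Nat.sub_le _ _)
  · rintro ⟨m, k⟩ h
    exact hsupp m k fun h' => h ⟨m, by simp; omega⟩

lemma hasSum_bsTerm (hN : 0 ≤ N) (n n' j j' : ℕ) :
    HasSum (bsTerm κ N n n' j j') (bsSum κ N n n' j j') := by
  refine (summable_of_abs_le_thermalProb_mul hN (n := n) (j := j)
    (a := n.factorial + n'.factorial) (b := 0) (fun m k h => ?_) fun m k _ => ?_).hasSum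
  · simp [bsTerm, bsCoeff_eq_zero κ h]
  · have hp := thermalProb_nonneg hN m
    rw [bsTerm, mul_assoc, mul_assoc, abs_mul, abs_mul, abs_of_nonneg hp,
      abs_of_nonneg (by positivity : (0 : ℝ) ≤ k.factorial / m.factorial), zero_mul, add_zero]
    exact mul_le_mul_of_nonneg_left (factorial_div_mul_abs_bsCoeff_mul_le κ n n' m j j' k) hp

lemma hasSum_bsCrossTerm (hN : 0 ≤ N) (n n' j j' : ℕ) :
    HasSum (bsCrossTerm κ N n n' j j') (bsCrossSum κ N n n' j j') := by
  refine (summable_of_abs_le_thermalProb_mul hN (n := n) (j := j)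
    (a := (n + 1) * n.factorial + n'.factorial) (b := n.factorial) (fun m k h => ?_)
    fun m k hk => ?_).hasSum
  · simp [bsCrossTerm, bsCoeff_eq_zero κ h]
  · have hp := thermalProb_nonneg hN m
    have hk' : (k : ℝ) ≤ n + m := by exact_mod_cast hk
    rw [bsCrossTerm, mul_assoc, mul_assoc, abs_mul, abs_mul, abs_of_nonneg hp,
      abs_of_nonneg (by positivity : (0 : ℝ) ≤ (k + 1).factorial / m.factorial)]
    refine mul_le_mul_of_nonneg_left
      ((factorial_succ_div_mul_abs_bsCoeff_mul_le κ n n' m j j' k).trans ?_) hp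
    nlinarith [(by positivity : (0 : ℝ) ≤ n.factorial)]

lemma bsSum_succ_eq_add_bsCrossSum (hN : 0 ≤ N) (n n' j j' : ℕ) :
    bsSum κ N (n + 1) n' j j' = √(κ : ℝ) * delay (fun i => bsSum κ N n n' i j') j
      + √(1 - (κ : ℝ)) * bsCrossSum κ N n n' j j' := by
  have hT := hasSum_delay_apply (fun i => hasSum_bsTerm κ hN n n' i j') j
  have hZ := hasSum_delay_snd_iff.mpr (hasSum_bsCrossTerm κ hN n n' j j')
  refine (hasSum_bsTerm κ hN (n + 1) n' j j').unique
    (((hT.mul_left _).add (hZ.mul_left _)).congr_fun ?_)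
  rintro ⟨m, k⟩
  rw [bsTerm, bsCoeff_succ_left]
  cases j <;> cases k <;> simp only [delay_zero, delay_succ, bsTerm, bsCrossTerm] <;> ring

lemma hasSum_bsCoeff_succ_right (hN : 0 ≤ N) (n n' j j' : ℕ) :
    HasSum (fun e : ℕ × ℕ => thermalProb N e.1 * (e.2.factorial / e.1.factorial)
        * bsCoeff κ n (e.1 + 1) j e.2 * bsCoeff κ n' e.1 j' e.2)
      (√(1 - (κ : ℝ)) * delay (fun i => bsSum κ N n n' i j') j
        - √(κ : ℝ) * bsCrossSum κ N n n' j j') := by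
  have hT := hasSum_delay_apply (fun i => hasSum_bsTerm κ hN n n' i j') j
  have hZ := hasSum_delay_snd_iff.mpr (hasSum_bsCrossTerm κ hN n n' j j')
  refine ((hT.mul_left _).sub (hZ.mul_left _)).congr_fun ?_
  rintro ⟨m, k⟩
  rw [bsCoeff_succ_right]
  cases j <;> cases k <;> simp only [delay_zero, delay_succ, bsTerm, bsCrossTerm] <;> ring

lemma bsCrossSum_eq (hN : 0 ≤ N) (n n' j j' : ℕ) :
    bsCrossSum κ N n n' j j' = √(1 - (κ : ℝ)) * (n' * bsSum κ N n (n' - 1) j j')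
      - √(κ : ℝ) * (N / (N + 1) * (√(1 - (κ : ℝ)) * delay (fun i => bsSum κ N n n' i j') j
        - √(κ : ℝ) * bsCrossSum κ N n n' j j')) := by
  have hT := (hasSum_bsTerm κ hN n (n' - 1) j j').mul_left (n' : ℝ)
  have hY := hasSum_delay_fst_iff.mpr
    ((hasSum_bsCoeff_succ_right κ hN n n' j j').mul_left (N / (N + 1)))
  refine (hasSum_bsCrossTerm κ hN n n' j j').unique
    (((hT.mul_left _).sub (hY.mul_left _)).congr_fun ?_)
  rintro ⟨m, k⟩
  have hstep := succ_mul_bsCoeff_succ κ n' m j' k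
  cases m with
  | zero =>
    simp only [delay_zero, bsTerm, bsCrossTerm, Nat.factorial_succ]
    push_cast at hstep ⊢
    linear_combination (thermalProb N 0 * (k.factorial / Nat.factorial 0)
      * bsCoeff κ n 0 j k) * hstep
  | succ m =>
    have hm : (m + 1 : ℝ) / (m + 1).factorial = 1 / m.factorial := by
      rw [Nat.factorial_succ]
      push_cast
      field
    simp only [delay_succ, bsTerm, bsCrossTerm, Nat.factorial_succ k, ← mul_assoc,
      ← thermalProb_succ]
    rw [Nat.add_sub_cancel] at hstep
    push_cast at hstep ⊢
    linear_combination (thermalProb N (m + 1) * (k.factorial / ((m + 1).factorial : ℝ))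
        * bsCoeff κ n (m + 1) j k) * hstep
      - √(κ : ℝ) * thermalProb N (m + 1) * k.factorial * bsCoeff κ n (m + 1) j k
        * bsCoeff κ n' m j' k * hm

end BeamSplitterKernel

/-! ### Thermal loss as pure loss followed by quantum-limited amplification -/

section LossKernel

variable (κ N : ℝ)

/-- The gain `1 + (1 - κ) N` of the amplifier. -/
def gain : ℝ := 1 + (1 - κ) * N

/-- One minus the transmittance of the pure-loss part. -/
def lossParam : ℝ := (1 - κ) * (N + 1) / gain κ N

/-- The amplification parameter `(G - 1) / G`, where `G` is the gain. -/
def ampParam : ℝ := (1 - κ) * N / gain κ N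

/-- The recursion satisfied by the kernel `⟨j|L(|n⟩⟨n'|)|j'⟩` of thermal loss, up to the
normalisation of the number states. -/
structure IsLossKernel (S : ℕ → ℕ → ℕ → ℕ → ℝ) : Prop where
  symm : ∀ n n' j j', S n n' j j' = S n' n j' j
  succ : ∀ n n' j j', S (n + 1) n' j j' = √κ / gain κ N * delay (fun i => S n n' i j') j
    + lossParam κ N * (n' * S n (n' - 1) j j')
  zero_zero : ∀ j j', S 0 0 j j' =
    if j = j' then ampParam κ N ^ j / (j.factorial * gain κ N) else 0

variable {κ N}

lemma IsLossKernel.unique {S T : ℕ → ℕ → ℕ → ℕ → ℝ} (hS : IsLossKernel κ N S)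
    (hT : IsLossKernel κ N T) (n n' j j' : ℕ) : S n n' j j' = T n n' j j' := by
  have hsucc : ∀ {n}, (∀ n' j j', S n n' j j' = T n n' j j') →
      ∀ n' j j', S (n + 1) n' j j' = T (n + 1) n' j j' := fun ih n' j j' => by
    simp only [hS.succ, hT.succ, ih]
  have hzero : ∀ n j j', S n 0 j j' = T n 0 j j' := by
    intro n
    induction n with
    | zero => intro j j'; rw [hS.zero_zero, hT.zero_zero]
    | succ n ih =>
      intro j j'
      simp only [hS.succ, hT.succ, ih]
  induction n generalizing n' j j' with
  | zero => rw [hS.symm, hT.symm, hzero]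
  | succ n ih => exact hsucc ih n' j j'

end LossKernel

section Parameters

variable {N : ℝ} (hN : 0 ≤ N) (κ : unitInterval)
include hN

lemma gain_pos : 0 < gain κ N :=
  add_pos_of_pos_of_nonneg one_pos (mul_nonneg (sub_nonneg.mpr κ.2.2) hN)

lemma lossParam_nonneg : 0 ≤ lossParam κ N :=
  div_nonneg (mul_nonneg (sub_nonneg.mpr κ.2.2) (by positivity)) (gain_pos hN κ).le

lemma ampParam_nonneg : 0 ≤ ampParam κ N :=
  div_nonneg (mul_nonneg (sub_nonneg.mpr κ.2.2) hN) (gain_pos hN κ).le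

lemma ampParam_lt_one : ampParam κ N < 1 := by
  rw [ampParam, div_lt_one (gain_pos hN κ), gain]
  linarith

lemma abs_ampParam_mul_lt_one {x : ℝ} (hx₀ : 0 ≤ x) (hx₁ : x ≤ 1) : |ampParam κ N * x| < 1 := by
  have hamp := ampParam_nonneg hN κ
  rw [abs_of_nonneg (mul_nonneg hamp hx₀)]
  exact (mul_le_of_le_one_right hamp hx₁).trans_lt (ampParam_lt_one hN κ)

end Parameters

section BeamSplitterKernel

variable (κ : unitInterval) {N : ℝ}

lemma bsSum_succ (hN : 0 ≤ N) (n n' j j' : ℕ) :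
    bsSum κ N (n + 1) n' j j' =
      √(κ : ℝ) / gain κ N * delay (fun i => bsSum κ N n n' i j') j
        + lossParam κ N * (n' * bsSum κ N n (n' - 1) j j') := by
  have ht : √(κ : ℝ) ^ 2 = κ := Real.sq_sqrt κ.2.1
  have hr : √(1 - (κ : ℝ)) ^ 2 = 1 - κ := Real.sq_sqrt (sub_nonneg.mpr κ.2.2)
  have hG := (gain_pos hN κ).ne'
  have hZ := bsCrossSum_eq κ hN n n' j j'
  rw [bsSum_succ_eq_add_bsCrossSum κ hN, lossParam]
  set t := √(κ : ℝ)
  set r := √(1 - (κ : ℝ))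
  set Z := bsCrossSum κ N n n' j j'
  set A := n' * bsSum κ N n (n' - 1) j j'
  set B := delay (fun i => bsSum κ N n n' i j') j
  have hZ' : Z * gain κ N = r * A * (N + 1) - t * N * r * B := by
    field_simp at hZ
    rw [gain]
    linear_combination hZ + Z * N * ht
  field_simp
  rw [gain] at hZ' ⊢
  linear_combination r * hZ' + (A * (N + 1) - t * N * B) * hr

lemma bsTerm_zero_zero (N : ℝ) (j k : ℕ) :
    bsTerm κ N 0 0 j j (j + k, k) =
      (N + 1)⁻¹ * (N / (N + 1) * (1 - κ)) ^ j / j.factorial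
        * ((k + j).choose j * (N / (N + 1) * κ) ^ k) := by
  have ht : (-√(κ : ℝ)) ^ k * (-√(κ : ℝ)) ^ k = κ ^ k := by
    rw [← mul_pow, neg_mul_neg, Real.mul_self_sqrt κ.2.1]
  have hr : √(1 - (κ : ℝ)) ^ j * √(1 - (κ : ℝ)) ^ j = (1 - κ) ^ j := by
    rw [← mul_pow, Real.mul_self_sqrt (sub_nonneg.mpr κ.2.2)]
  simp only [bsTerm, bsCoeff_zero_add, thermalProb_eq, add_comm k j, Nat.cast_add_choose]
  rw [mul_pow, mul_pow, ← hr, ← ht, pow_add]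
  field

lemma bsSum_zero_zero (hN : 0 ≤ N) (j j' : ℕ) :
    bsSum κ N 0 0 j j' = if j = j' then ampParam κ N ^ j / (j.factorial * gain κ N) else 0 := by
  split_ifs with hjj
  · subst hjj
    have hG := gain_pos hN κ
    have hq : ‖N / (N + 1) * κ‖ < 1 := by
      have hκ₀ : 0 ≤ (κ : ℝ) := κ.2.1
      rw [Real.norm_of_nonneg (by positivity)]
      exact (mul_le_of_le_one_right (by positivity) κ.2.2).trans_lt (div_add_one_lt_one hN)
    have hsum := (hasSum_choose_mul_geometric_of_norm_lt_one j hq).mul_left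
      ((N + 1)⁻¹ * (N / (N + 1) * (1 - κ)) ^ j / j.factorial)
    have hinj : Function.Injective fun k : ℕ => (j + k, k) := fun a b h => (Prod.ext_iff.mp h).2
    have hden : 1 - N / (N + 1) * (κ : ℝ) = gain κ N / (N + 1) := by
      rw [gain]; field_simp; ring
    have hterm := (hinj.hasSum_iff (f := bsTerm κ N 0 0 j j) ?_).mp
      (hsum.congr_fun (bsTerm_zero_zero κ N j))
    · rw [bsSum, hterm.tsum_eq, hden, ampParam]
      simp only [div_pow, mul_pow, pow_succ]
      field
    · rintro ⟨m, k⟩ h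
      have : 0 + m ≠ j + k := fun h' => h ⟨k, by simp; omega⟩
      simp [bsTerm, bsCoeff_eq_zero κ this]
  · refine (tsum_congr fun e => ?_).trans tsum_zero
    rw [bsTerm]
    by_cases h : 0 + e.1 = j + e.2
    · rw [bsCoeff_eq_zero κ (show 0 + e.1 ≠ j' + e.2 by omega), mul_zero]
    · rw [bsCoeff_eq_zero κ h, mul_zero, zero_mul]

lemma isLossKernel_bsSum (hN : 0 ≤ N) : IsLossKernel κ N (bsSum κ N) where
  symm := bsSum_symm κ N
  succ := bsSum_succ κ hN
  zero_zero := bsSum_zero_zero κ hN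

end BeamSplitterKernel

section Amplifier

variable (κ N : ℝ)

/-- The amplitude, from `n` to `j` photons and up to the normalisation of the number states, for
losing `l` photons in the pure-loss part and gaining `a` photons in the amplification part. -/
def ampCoeff (n a j l : ℕ) : ℝ :=
  if n + a = j + l then n.descFactorial l * (√κ / gain κ N) ^ (n - l) else 0

/-- The weight of the Kraus operator gaining `a` and losing `l` photons. -/
def ampWeight (a l : ℕ) : ℝ :=
  lossParam κ N ^ l / l.factorial * (ampParam κ N ^ a / a.factorial) / gain κ N

/-- The summand of `ampSum`, indexed by the numbers of gained and of lost photons. -/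
def ampTerm (n n' j j' : ℕ) (e : ℕ × ℕ) : ℝ :=
  ampWeight κ N e.1 e.2 * ampCoeff κ N n e.1 j e.2 * ampCoeff κ N n' e.1 j' e.2

/-- The kernel of pure loss followed by quantum-limited amplification, up to the normalisation of
the number states. -/
def ampSum (n n' j j' : ℕ) : ℝ := ∑' e, ampTerm κ N n n' j j' e

lemma ampCoeff_eq_zero {n a j l : ℕ} (h : n + a ≠ j + l) : ampCoeff κ N n a j l = 0 := if_neg h

lemma ampCoeff_eq {n a j l : ℕ} (h : n + a = j + l) :
    ampCoeff κ N n a j l = n.descFactorial l * (√κ / gain κ N) ^ (n - l) := if_pos h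

lemma hasSum_ampTerm_range (n n' j j' : ℕ) :
    HasSum (ampTerm κ N n n' j j')
      (∑ l ∈ Finset.range (n + 1), ampTerm κ N n n' j j' (j + l - n, l)) := by
  have hinj : Function.Injective fun l : ℕ => (j + l - n, l) := fun a b h => (Prod.ext_iff.mp h).2
  refine (hinj.hasSum_iff ?_).mp (hasSum_sum_of_ne_finset_zero fun l hl => ?_)
  · rintro ⟨a, l⟩ h
    have : n + a ≠ j + l := fun h' => h ⟨l, by simp; omega⟩
    simp [ampTerm, ampCoeff_eq_zero κ N this]
  · have : n < l := by simpa using hl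
    simp [ampTerm, ampCoeff, Nat.descFactorial_eq_zero_iff_lt.mpr this]

lemma hasSum_ampTerm (n n' j j' : ℕ) :
    HasSum (ampTerm κ N n n' j j') (ampSum κ N n n' j j') :=
  (hasSum_ampTerm_range κ N n n' j j').summable.hasSum

lemma succ_descFactorial_succ_eq_add (n l : ℕ) :
    (n + 1).descFactorial (l + 1) = n.descFactorial (l + 1) + (l + 1) * n.descFactorial l := by
  rw [Nat.succ_descFactorial_succ, Nat.descFactorial_succ, ← add_mul]
  rcases le_or_gt l n with h | h
  · rw [show n - l + (l + 1) = n + 1 by omega]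
  · simp [Nat.descFactorial_eq_zero_iff_lt.mpr h]

lemma ampCoeff_succ_left (n a j l : ℕ) :
    ampCoeff κ N (n + 1) a j l = √κ / gain κ N * delay (fun i => ampCoeff κ N n a i l) j
      + l * ampCoeff κ N n a j (l - 1) := by
  by_cases h : n + 1 + a = j + l
  · rw [ampCoeff_eq κ N h]
    match j, l with
    | 0, 0 => omega
    | j + 1, 0 =>
      rw [delay_succ, ampCoeff_eq κ N (by omega)]
      simp [pow_succ']
    | 0, l + 1 =>
      rw [delay_zero, Nat.add_sub_cancel, ampCoeff_eq κ N (by omega),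
        succ_descFactorial_succ_eq_add, Nat.descFactorial_of_lt (by omega : n < l + 1),
        Nat.add_sub_add_right]
      push_cast
      ring
    | j + 1, l + 1 =>
      rw [delay_succ, Nat.add_sub_cancel, ampCoeff_eq κ N (by omega), ampCoeff_eq κ N (by omega),
        succ_descFactorial_succ_eq_add, Nat.add_sub_add_right]
      have hpow : √κ / gain κ N * (n.descFactorial (l + 1) * (√κ / gain κ N) ^ (n - (l + 1)))
          = n.descFactorial (l + 1) * (√κ / gain κ N) ^ (n - l) := by
        rcases lt_or_ge l n with hl | hl
        · rw [show n - l = n - (l + 1) + 1 by omega]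
          ring
        · rw [Nat.descFactorial_of_lt (by omega : n < l + 1)]
          simp
      rw [hpow]
      push_cast
      ring
  · rw [ampCoeff_eq_zero κ N h]
    match j, l with
    | 0, 0 => simp
    | j + 1, 0 => simp [ampCoeff_eq_zero κ N (show n + a ≠ j + 0 by omega)]
    | 0, l + 1 => simp [ampCoeff_eq_zero κ N (show n + a ≠ 0 + l by omega)]
    | j + 1, l + 1 =>
      rw [delay_succ, Nat.add_sub_cancel, ampCoeff_eq_zero κ N (by omega),
        ampCoeff_eq_zero κ N (by omega), mul_zero, mul_zero, add_zero]

lemma ampCoeff_succ_right (n a j l : ℕ) :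
    ampCoeff κ N n a j (l + 1) = n * ampCoeff κ N (n - 1) a j l := by
  rcases n with _ | n
  · simp [ampCoeff]
  · have h : n + 1 + a = j + (l + 1) ↔ n + a = j + l := by omega
    simp only [ampCoeff, h, Nat.succ_descFactorial_succ, Nat.add_sub_add_right, Nat.add_sub_cancel]
    split_ifs <;> push_cast <;> ring

lemma ampWeight_succ_right (a l : ℕ) :
    ampWeight κ N a (l + 1) * (l + 1) = lossParam κ N * ampWeight κ N a l := by
  rw [ampWeight, ampWeight, Nat.factorial_succ, pow_succ]
  push_cast
  field

lemma ampSum_succ (n n' j j' : ℕ) :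
    ampSum κ N (n + 1) n' j j' = √κ / gain κ N * delay (fun i => ampSum κ N n n' i j') j
      + lossParam κ N * (n' * ampSum κ N n (n' - 1) j j') := by
  have hT := hasSum_delay_apply (fun i => hasSum_ampTerm κ N n n' i j') j
  have hY := hasSum_delay_snd_iff.mpr
    (((hasSum_ampTerm κ N n (n' - 1) j j').mul_left (n' : ℝ)).mul_left (lossParam κ N))
  refine (hasSum_ampTerm κ N (n + 1) n' j j').unique
    (((hT.mul_left _).add hY).congr_fun ?_)
  rintro ⟨a, l⟩
  rw [ampTerm, ampCoeff_succ_left]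
  cases l with
  | zero => cases j <;> simp only [delay_zero, delay_succ, ampTerm] <;> push_cast <;> ring
  | succ l =>
    have hw := ampWeight_succ_right κ N a l
    cases j <;> simp only [delay_zero, delay_succ, ampTerm, ampCoeff_succ_right,
      Nat.add_sub_cancel] <;> push_cast
    all_goals linear_combination (ampCoeff κ N n a _ l * (n' * ampCoeff κ N (n' - 1) a j' l)) * hw

lemma ampSum_zero_zero (j j' : ℕ) :
    ampSum κ N 0 0 j j' = if j = j' then ampParam κ N ^ j / (j.factorial * gain κ N) else 0 := by
  rw [ampSum, (hasSum_ampTerm_range κ N 0 0 j j').tsum_eq]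
  by_cases h : j = j'
  · subst h
    simp [ampTerm, ampCoeff, ampWeight, div_div]
  · simp [ampTerm, ampCoeff, h]

lemma isLossKernel_ampSum : IsLossKernel κ N (ampSum κ N) where
  symm n n' j j' := tsum_congr fun e => by unfold ampTerm; ring
  succ := ampSum_succ κ N
  zero_zero := ampSum_zero_zero κ N

variable {κ}

lemma factorial_div_mul_ampTerm (hκ : 0 ≤ κ) (l p a : ℕ) :
    ((a + p).factorial / (l + p).factorial : ℝ)
        * ampTerm κ N (l + p) (l + p) (a + p) (a + p) (a, l) =
      (gain κ N)⁻¹ * (lossParam κ N ^ l * (κ / gain κ N ^ 2) ^ p * (l + p).choose l)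
        * ((a + p).choose p * ampParam κ N ^ a) := by
  have hdesc : ((l + p).descFactorial l : ℝ) = (l + p).factorial / p.factorial := by
    have := Nat.factorial_mul_descFactorial (Nat.le_add_right l p)
    rw [Nat.add_sub_cancel_left] at this
    rw [eq_div_iff (by positivity), mul_comm]
    exact_mod_cast this
  have hg : (κ / gain κ N ^ 2) ^ p = (√κ / gain κ N) ^ p * (√κ / gain κ N) ^ p := by
    rw [← mul_pow, div_mul_div_comm, Real.mul_self_sqrt hκ, ← sq]
  rw [ampTerm, ampCoeff_eq κ N (by omega), ampWeight, Nat.add_sub_cancel_left, hdesc, hg,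
    Nat.cast_add_choose, add_comm a p, Nat.cast_add_choose]
  field

end Amplifier

section GeneratingFunction

variable {κ : unitInterval} {N : ℝ}

/-- The kernel `⟨j|L(|n⟩⟨n'|)|j'⟩` of the single-mode thermal loss channel `L`. -/
def lossKernel (κ : unitInterval) (N : ℝ) (n n' j j' : ℕ) : ℝ :=
  √((j.factorial : ℝ) / n.factorial) * √((j'.factorial : ℝ) / n'.factorial) * bsSum κ N n n' j j'

lemma bsSum_eq_ampSum (hN : 0 ≤ N) (n n' j j' : ℕ) :
    bsSum κ N n n' j j' = ampSum κ N n n' j j' :=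
  (isLossKernel_bsSum κ hN).unique (isLossKernel_ampSum κ N) n n' j j'

lemma lossKernel_diag (hN : 0 ≤ N) (n j : ℕ) :
    lossKernel κ N n n j j = ∑ l ∈ Finset.range (n + 1),
      (j.factorial / n.factorial : ℝ) * ampTerm κ N n n j j (j + l - n, l) := by
  rw [lossKernel, Real.mul_self_sqrt (by positivity), bsSum_eq_ampSum hN, ampSum,
    (hasSum_ampTerm_range κ N n n j j).tsum_eq, Finset.mul_sum]

lemma hasSum_ampTerm_mul_pow (hN : 0 ≤ N) {x : ℝ} (hx₀ : 0 ≤ x) (hx₁ : x ≤ 1) {n l : ℕ}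
    (hl : l ≤ n) :
    HasSum (fun j => (j.factorial / n.factorial : ℝ) * ampTerm κ N n n j j (j + l - n, l) * x ^ j)
      ((gain κ N * (1 - ampParam κ N * x))⁻¹ * (lossParam κ N ^ l
        * (κ / gain κ N ^ 2 * x / (1 - ampParam κ N * x)) ^ (n - l) * n.choose l)) := by
  obtain ⟨p, rfl⟩ := Nat.exists_eq_add_of_le hl
  have hgeom := (hasSum_choose_mul_geometric_of_norm_lt_one p
    (abs_ampParam_mul_lt_one hN κ hx₀ hx₁)).mul_left
    ((gain κ N)⁻¹ * (lossParam κ N ^ l * (κ / gain κ N ^ 2) ^ p * (l + p).choose l) * x ^ p)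
  have hsum := ((add_left_injective p).hasSum_iff (f := fun j => (j.factorial
    / (l + p).factorial : ℝ) * ampTerm κ N (l + p) (l + p) j j (j + l - (l + p), l) * x ^ j)
    (fun j hj => ?_)).mp (hgeom.congr_fun fun a => ?_)
  · convert hsum using 1
    rw [Nat.add_sub_cancel_left, div_pow, mul_pow, pow_succ]
    field
  · have hjp : j < p := not_le.mp fun h => hj ⟨j - p, Nat.sub_add_cancel h⟩
    simp [ampTerm, ampCoeff, show l + p + (j + l - (l + p)) ≠ j + l by omega]
  · simp only [Function.comp_apply]
    rw [show a + p + l - (l + p) = a by omega, factorial_div_mul_ampTerm N κ.2.1]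
    ring

lemma hasSum_lossKernel_mul_pow (hN : 0 ≤ N) {x : ℝ} (hx₀ : 0 ≤ x) (hx₁ : x ≤ 1) (n : ℕ) :
    HasSum (fun j => lossKernel κ N n n j j * x ^ j)
      ((1 + (1 - κ) * N * (1 - x))⁻¹
        * (1 + (x - 1) * κ / (1 + (1 - κ) * N * (1 - x))) ^ n) := by
  have hG := gain_pos hN κ
  have hvx : 0 < 1 - ampParam κ N * x :=
    sub_pos.mpr (lt_of_abs_lt (abs_ampParam_mul_lt_one hN κ hx₀ hx₁))
  have hD : 1 + (1 - κ) * N * (1 - x) = gain κ N * (1 - ampParam κ N * x) := by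
    have hv : gain κ N * ampParam κ N = (1 - κ) * N := mul_div_cancel₀ _ hG.ne'
    rw [mul_sub _ 1 (_ * _), ← mul_assoc (gain κ N), hv, gain]
    ring
  have hbase : lossParam κ N + κ / gain κ N ^ 2 * x / (1 - ampParam κ N * x)
      = 1 + (x - 1) * κ / (1 + (1 - κ) * N * (1 - x)) := by
    have hloss : lossParam κ N = 1 - κ / gain κ N := by
      rw [lossParam, eq_sub_iff_add_eq, ← add_div, div_eq_one_iff_eq hG.ne', gain]
      ring
    have hx : gain κ N * (1 - x) = gain κ N * (1 - ampParam κ N * x) - x := by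
      rw [← hD, gain]
      ring
    rw [hloss, hD]
    generalize 1 - ampParam κ N * x = D at hvx hx
    field_simp
    linear_combination κ * hx
  have hsum := (hasSum_sum fun l hl =>
    hasSum_ampTerm_mul_pow hN hx₀ hx₁ (κ := κ) (n := n) (Finset.mem_range_succ_iff.mp hl))
  rw [← Finset.mul_sum, ← add_pow, hbase, ← hD] at hsum
  exact hsum.congr_fun fun j => by rw [lossKernel_diag hN, Finset.sum_mul]

lemma hasSum_lossKernel (hN : 0 ≤ N) (n : ℕ) : HasSum (fun j => lossKernel κ N n n j j) 1 := by
  simpa using hasSum_lossKernel_mul_pow hN zero_le_one le_rfl n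

end GeneratingFunction

/-! ### Operations on ensembles -/

lemma hasSum_prod_of_nonneg {α β : Type*} {f : α × β → ℝ} {g : α → ℝ} {c : ℝ}
    (hf : ∀ z, 0 ≤ f z) (hg : ∀ a, HasSum (fun b => f (a, b)) (g a)) (hc : HasSum g c) :
    HasSum f c := by
  have hs : Summable f := (summable_prod_of_nonneg hf).mpr
    ⟨fun a => (hg a).summable, by simpa only [(hg _).tsum_eq] using hc.summable⟩
  rw [hc.unique (hs.hasSum.prod_fiberwise hg)]
  exact hs.hasSum

lemma hasSum_tsum_swap_of_nonneg {α β : Type*} {f : α × β → ℝ} {g : α → ℝ} {c : ℝ}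
    (hf : ∀ z, 0 ≤ f z) (hg : ∀ a, HasSum (fun b => f (a, b)) (g a)) (hc : HasSum g c) :
    HasSum (fun b => ∑' a, f (a, b)) c ∧ ∀ b, Summable fun a => f (a, b) := by
  have h := (Equiv.prodComm β α).hasSum_iff.mpr (hasSum_prod_of_nonneg hf hg hc)
  exact ⟨h.prod_fiberwise fun b => (h.summable.prod_factor b).hasSum, h.summable.prod_factor⟩

section Operation

open InnerProductSpace ContinuousLinearMap

variable {A B H K : Type*} [NormedAddCommGroup H] [InnerProductSpace ℂ H] [CompleteSpace H]
  [NormedAddCommGroup K] [InnerProductSpace ℂ K] [CompleteSpace K]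

lemma comp_rankOne_self_comp_adjoint (T : H →L[ℂ] K) (x : H) :
    T ∘L rankOne ℂ x x ∘L adjoint T = rankOne ℂ (T x) (T x) := by
  rw [rankOne_comp, adjoint_adjoint, comp_rankOne]

lemma smul_comp_comp_adjoint {p : ℝ} (hp : 0 ≤ p) (T : H →L[ℂ] K) (X : H →L[ℂ] H) :
    (p : ℂ) • (T ∘L X ∘L adjoint T)
      = (((√p : ℝ) : ℂ) • T) ∘L X ∘L adjoint (((√p : ℝ) : ℂ) • T) := by
  rw [map_smulₛₗ, Complex.conj_ofReal, comp_smul, smul_comp, comp_smul, smul_smul,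
    ← Complex.ofReal_mul, Real.mul_self_sqrt hp]

variable {T : A → H →L[ℂ] K} (hT : ∀ x, HasSum (fun a => ‖T a x‖ ^ 2) (‖x‖ ^ 2))
include hT

lemma isEnsemble_kraus_rankOne {x : H} (hx : ‖x‖ = 1) :
    IsEnsemble (fun a => T a x) (∑' a, T a ∘L rankOne ℂ x x ∘L adjoint (T a)) :=
  .of_hasSum_norm_sq (by simpa [hx] using hT x)
    (tsum_congr fun a => comp_rankOne_self_comp_adjoint (T a) x)

lemma IsEnsemble.kraus {v : B → H} {ρ : H →L[ℂ] H} (hv : IsEnsemble v ρ) :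
    IsEnsemble (fun z : A × B => T z.1 (v z.2)) (∑' a, T a ∘L ρ ∘L adjoint (T a)) := by
  have hnorm : HasSum (fun z : A × B => ‖T z.1 (v z.2)‖ ^ 2) 1 :=
    (Equiv.prodComm B A).hasSum_iff.mp
      (hasSum_prod_of_nonneg (fun _ => sq_nonneg _) (fun b => hT (v b)) hv.hasSum_norm_sq)
  have hens := IsEnsemble.of_hasSum_norm_sq hnorm rfl
  refine ⟨hnorm, ?_⟩
  rw [(hens.hasSum_rankOne.prod_fiberwise fun a => ?_).tsum_eq]
  · exact hens.hasSum_rankOne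
  · simp only [← comp_rankOne_self_comp_adjoint]
    exact hv.hasSum_rankOne.mapL
      (compL ℂ K H K (T a) ∘L (compL ℂ K H H).flip (adjoint (T a)))

end Operation

/-! ### Kraus families conserving the photon number -/

lemma hasSum_norm_sq_apply {ι H : Type*} [NormedAddCommGroup H] (ψ : lp (fun _ : ι => H) 2) :
    HasSum (fun n => ‖ψ n‖ ^ 2) (‖ψ‖ ^ 2) := by
  simpa using lp.hasSum_norm (p := 2) (by norm_num) ψ

/-- The real numbers `A n m j k = ⟨j|K_{m,k}|n⟩` are the matrix elements, in the number basis, of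
Kraus operators `K_{m,k}` of a trace-preserving channel with kernel
`S n n' j j' = ⟨j|L(|n⟩⟨n'|)|j'⟩`. The operator `K_{m,k}` turns `m` background photons into `k`
environment photons, and the total photon number is conserved. Photon numbers range over `ι`, so
that `ι = ℕ` is a single mode and `ι = Fin M → ℕ` are `M` modes. -/
structure IsKrausFamily {ι : Type*} [Add ι] (A S : ι → ι → ι → ι → ℝ) : Prop where
  eq_zero : ∀ n m j k, n + m ≠ j + k → A n m j k = 0
  hasSum_kernel : ∀ n n' j j',
    HasSum (fun e : ι × ι => A n e.1 j e.2 * A n' e.1 j' e.2) (S n n' j j')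
  hasSum_diag : ∀ n, HasSum (fun j => S n n j j) 1

namespace IsKrausFamily

variable {ι H : Type*} [Add ι] [NormedAddCommGroup H] {A S : ι → ι → ι → ι → ℝ}

lemma kernel_diag_nonneg (h : IsKrausFamily A S) (n j : ι) : 0 ≤ S n n j j :=
  (h.hasSum_kernel n n j j).nonneg fun _ => mul_self_nonneg _

lemma hasSum_tsum_kernel_mul_norm_sq (h : IsKrausFamily A S) (ψ : lp (fun _ : ι => H) 2) :
    HasSum (fun j => ∑' n, S n n j j * ‖ψ n‖ ^ 2) (‖ψ‖ ^ 2) ∧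
      ∀ j, Summable fun n => S n n j j * ‖ψ n‖ ^ 2 :=
  hasSum_tsum_swap_of_nonneg (f := fun z : ι × ι => S z.1 z.1 z.2 z.2 * ‖ψ z.1‖ ^ 2)
    (g := fun n => ‖ψ n‖ ^ 2) (fun _ => mul_nonneg (h.kernel_diag_nonneg _ _) (sq_nonneg _))
    (fun n => by simpa using (h.hasSum_diag n).mul_right (‖ψ n‖ ^ 2)) (hasSum_norm_sq_apply ψ)

end IsKrausFamily

section TensorKet

variable {ι H : Type*} [DecidableEq ι] [NormedAddCommGroup H] [InnerProductSpace ℂ H]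

/-- The map `x ↦ x ⊗ |n⟩`. -/
def tensorKet (n : ι) : H →L[ℂ] lp (fun _ : ι => H) 2 :=
  lp.singleContinuousLinearMap ℂ (fun _ => H) 2 n

lemma inner_tensorKet_left (n : ι) (x : H) (φ : lp (fun _ : ι => H) 2) :
    ⟪tensorKet n x, φ⟫_ℂ = ⟪x, φ n⟫_ℂ :=
  lp.inner_single_left (𝕜 := ℂ) (G := fun _ : ι => H) n x φ

lemma inner_tensorKet_right (n : ι) (x : H) (φ : lp (fun _ : ι => H) 2) :
    ⟪φ, tensorKet n x⟫_ℂ = ⟪φ n, x⟫_ℂ :=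
  lp.inner_single_right (𝕜 := ℂ) (G := fun _ : ι => H) n x φ

lemma norm_tensorKet (n : ι) (x : H) : ‖tensorKet n x‖ = ‖x‖ :=
  lp.norm_single (E := fun _ : ι => H) (p := 2) (by norm_num) n x

lemma adjoint_tensorKet [CompleteSpace H] (n : ι) :
    ContinuousLinearMap.adjoint (tensorKet n : H →L[ℂ] _) = lp.evalCLM ℂ (fun _ => H) 2 n :=
  ((ContinuousLinearMap.eq_adjoint_iff _ _).mpr fun φ x =>
    (inner_tensorKet_right n x φ).symm).symm

lemma ext_inner_tensorKet {S T : lp (fun _ : ι => H) 2 →L[ℂ] lp (fun _ : ι => H) 2}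
    (h : ∀ j x j' y,
      ⟪tensorKet j x, S (tensorKet j' y)⟫_ℂ = ⟪tensorKet j x, T (tensorKet j' y)⟫_ℂ) :
    S = T := by
  refine lp.ext_continuousLinearMap (by norm_num) fun j' => ?_
  ext y j
  refine ext_inner_left ℂ fun x => ?_
  exact (inner_tensorKet_left j x _).symm.trans ((h j x j' y).trans (inner_tensorKet_left j x _))

end TensorKet

/-- The component along `|j⟩` of `(1 ⊗ K_{m,k}) ψ`, where `e = (m, k)` and `A` holds the matrix
elements of `K_{m,k}`. Photon number conservation leaves the single input `|j + k - m⟩`, and the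
truncated subtraction is harmless because `A` vanishes when `j + k < m`. -/
def krausComponent {ι H : Type*} [Add ι] [Sub ι] [SMul ℂ H] (A : ι → ι → ι → ι → ℝ) (ψ : ι → H)
    (e : ι × ι) (j : ι) : H :=
  ((A (j + e.2 - e.1) e.1 j e.2 : ℝ) : ℂ) • ψ (j + e.2 - e.1)

namespace IsKrausFamily

open InnerProductSpace

variable {ι H : Type*} [AddCommMonoid ι] [PartialOrder ι] [Sub ι] [OrderedSub ι]
  [AddLeftReflectLE ι] [NormedAddCommGroup H] [InnerProductSpace ℂ H]
  {A B S : ι → ι → ι → ι → ℝ}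

lemma eq_zero_of_ne_sub (h : IsKrausFamily A S) {n m j k : ι} (hn : n ≠ j + k - m) :
    A n m j k = 0 :=
  h.eq_zero n m j k fun h' => hn (by rw [← h', add_tsub_cancel_right])

lemma hasSum_norm_sq_krausComponent (h : IsKrausFamily A S) {ψ : ι → H} {j : ι} {c : ℝ}
    (hc : HasSum (fun n => S n n j j * ‖ψ n‖ ^ 2) c) :
    HasSum (fun e => ‖krausComponent A ψ e j‖ ^ 2) c := by
  let F (z : ι × ι × ι) : ℝ := A z.1 z.2.1 j z.2.2 * A z.1 z.2.1 j z.2.2 * ‖ψ z.1‖ ^ 2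
  have hF : HasSum F c :=
    hasSum_prod_of_nonneg (g := fun n => S n n j j * ‖ψ n‖ ^ 2)
      (fun _ => mul_nonneg (mul_self_nonneg _) (sq_nonneg _))
      (fun n => (h.hasSum_kernel n n j j).mul_right (‖ψ n‖ ^ 2)) hc
  have hinj : Function.Injective fun e : ι × ι => (j + e.2 - e.1, e) :=
    fun _ _ he => congrArg Prod.snd he
  refine ((hinj.hasSum_iff ?_).mpr hF).congr_fun fun e => ?_
  · rintro ⟨n, e⟩ hz
    have hn : n ≠ j + e.2 - e.1 := fun hn => hz ⟨e, by rw [hn]⟩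
    simp only [F, h.eq_zero_of_ne_sub hn, zero_mul]
  · simp only [F, krausComponent, norm_smul, mul_pow, Complex.norm_real, Real.norm_eq_abs, sq_abs,
      Function.comp_apply, ← sq]

lemma hasSum_norm_sq_krausComponent_prod (h : IsKrausFamily A S) (ψ : lp (fun _ : ι => H) 2) :
    HasSum (fun z : (ι × ι) × ι => ‖krausComponent A ψ z.1 z.2‖ ^ 2) (‖ψ‖ ^ 2) :=
  (Equiv.prodComm ι (ι × ι)).hasSum_iff.mp (hasSum_prod_of_nonneg (fun _ => sq_nonneg _)
    (fun j => h.hasSum_norm_sq_krausComponent ((h.hasSum_tsum_kernel_mul_norm_sq ψ).2 j).hasSum)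
    (h.hasSum_tsum_kernel_mul_norm_sq ψ).1)

variable (h : IsKrausFamily A S) (ψ : lp (fun _ : ι => H) 2)

/-- The vectors `(1 ⊗ K_{m,k}) ψ`, indexed by `(m, k)`. -/
def vec (e : ι × ι) : lp (fun _ : ι => H) 2 :=
  ⟨krausComponent A ψ e,
    memℓp_gen (by simpa using (h.hasSum_norm_sq_krausComponent_prod ψ).summable.prod_factor e)⟩

lemma vec_apply (e : ι × ι) (j : ι) :
    h.vec ψ e j = ((A (j + e.2 - e.1) e.1 j e.2 : ℝ) : ℂ) • ψ (j + e.2 - e.1) := rfl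

lemma hasSum_norm_sq_vec : HasSum (fun e => ‖h.vec ψ e‖ ^ 2) (‖ψ‖ ^ 2) :=
  (h.hasSum_norm_sq_krausComponent_prod ψ).prod_fiberwise fun e => hasSum_norm_sq_apply (h.vec ψ e)

lemma hasSum_norm_sq_vec_apply (j : ι) :
    HasSum (fun e => ‖h.vec ψ e j‖ ^ 2) (∑' n, S n n j j * ‖ψ n‖ ^ 2) :=
  h.hasSum_norm_sq_krausComponent ((h.hasSum_tsum_kernel_mul_norm_sq ψ).2 j).hasSum

variable {ψ}

lemma tsum_inner_vec_mul_inner_vec {x y : H} {j j' : ι}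
    (hs : Summable fun e => ⟪x, h.vec ψ e j⟫_ℂ * ⟪h.vec ψ e j', y⟫_ℂ) :
    ∑' e, ⟪x, h.vec ψ e j⟫_ℂ * ⟪h.vec ψ e j', y⟫_ℂ
      = ∑' q : ι × ι, ((S q.1 q.2 j j' : ℝ) : ℂ) * (⟪x, ψ q.1⟫_ℂ * ⟪ψ q.2, y⟫_ℂ) := by
  let F (z : (ι × ι) × (ι × ι)) : ℂ :=
    ((A z.2.1 z.1.1 j z.1.2 * A z.2.2 z.1.1 j' z.1.2 : ℝ) : ℂ) * (⟪x, ψ z.2.1⟫_ℂ * ⟪ψ z.2.2, y⟫_ℂ)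
  let g (e : ι × ι) : (ι × ι) × (ι × ι) := (e, (j + e.2 - e.1, j' + e.2 - e.1))
  have hinj : Function.Injective g := fun a b hab => (Prod.ext_iff.mp hab).1
  have hFg : (fun e => ⟪x, h.vec ψ e j⟫_ℂ * ⟪h.vec ψ e j', y⟫_ℂ) = F ∘ g := by
    funext e
    simp only [F, g, vec_apply, Function.comp_apply, inner_smul_left, inner_smul_right,
      Complex.conj_ofReal]
    push_cast
    ring
  have hzero : ∀ z ∉ Set.range g, F z = 0 := by
    rintro ⟨e, n, n'⟩ hz
    by_cases hn : n = j + e.2 - e.1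
    · have hn' : n' ≠ j' + e.2 - e.1 := fun hn' => hz ⟨e, by simp only [g, hn, hn']⟩
      simp [F, h.eq_zero_of_ne_sub hn']
    · simp [F, h.eq_zero_of_ne_sub hn]
  rw [hFg] at hs ⊢
  have hsF : Summable F := (hinj.summable_iff hzero).mp hs
  rw [((hinj.hasSum_iff hzero).mpr hsF.hasSum).tsum_eq, hsF.tsum_prod,
    ← Summable.tsum_comm (f := fun e q => F (e, q)) hsF]
  refine tsum_congr fun q => ?_
  simp only [F]
  rw [tsum_mul_right, (Complex.hasSum_ofReal.mpr (h.hasSum_kernel q.1 q.2 j j')).tsum_eq]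

lemma tsum_rankOne_vec_eq [CompleteSpace H] (hA : IsKrausFamily A S)
    (hB : IsKrausFamily B S) (ψ : lp (fun _ : ι => H) 2) :
    ∑' e, rankOne ℂ (hA.vec ψ e) (hA.vec ψ e) = ∑' e, rankOne ℂ (hB.vec ψ e) (hB.vec ψ e) := by
  classical
  refine ext_inner_tensorKet fun j x j' y => ?_
  have hasSum_matrixElement {A : ι → ι → ι → ι → ℝ} (h : IsKrausFamily A S) :
      HasSum (fun e => ⟪x, h.vec ψ e j⟫_ℂ * ⟪h.vec ψ e j', y⟫_ℂ)
        ⟪tensorKet j x, (∑' e, rankOne ℂ (h.vec ψ e) (h.vec ψ e)) (tensorKet j' y)⟫_ℂ := by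
    have hs : Summable fun e => rankOne ℂ (h.vec ψ e) (h.vec ψ e) :=
      .of_norm (by simpa only [norm_rankOne, ← sq] using (h.hasSum_norm_sq_vec ψ).summable)
    refine (hs.hasSum.mapL (innerSL ℂ (tensorKet j x) ∘L
      ContinuousLinearMap.apply ℂ _ (tensorKet j' y))).congr_fun fun e => ?_
    simp [inner_tensorKet_left, inner_tensorKet_right, mul_comm]
  have hsumA := hasSum_matrixElement hA
  have hsumB := hasSum_matrixElement hB
  rw [← hsumA.tsum_eq, ← hsumB.tsum_eq, hA.tsum_inner_vec_mul_inner_vec hsumA.summable,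
    hB.tsum_inner_vec_mul_inner_vec hsumB.summable]

end IsKrausFamily

/-! ### The multi-mode thermal loss channel -/

lemma hasSum_mul_prod {α β : Type*} {f : α → ℝ} {g : β → ℝ} {a b : ℝ} (hf : HasSum f a)
    (hg : HasSum g b) : HasSum (fun x : α × β => f x.1 * g x.2) (a * b) :=
  hf.mul hg (summable_mul_of_summable_norm hf.summable.norm hg.summable.norm)

lemma hasSum_pi_prod {M : ℕ} {α : Type*} {f : Fin M → α → ℝ} {s : Fin M → ℝ}
    (h : ∀ i, HasSum (f i) (s i)) :
    HasSum (fun e : Fin M → α => ∏ i, f i (e i)) (∏ i, s i) := by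
  induction M with
  | zero => simp
  | succ M ih =>
    have hprod := hasSum_mul_prod (h 0) (ih fun i => h i.succ)
    rw [Fin.prod_univ_succ]
    refine ((Fin.consEquiv fun _ : Fin (M + 1) => α).hasSum_iff
      (f := fun e : Fin (M + 1) → α => ∏ i, f i (e i))).mp (hprod.congr_fun fun e => ?_)
    simp [Fin.prod_univ_succ, Fin.consEquiv]

/-- The product over `M` modes of single-mode matrix elements. -/
def modeProd {M : ℕ} {α : Type*} (S : α → α → α → α → ℝ) (n n' j j' : Fin M → α) : ℝ :=
  ∏ i, S (n i) (n' i) (j i) (j' i)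

lemma IsKrausFamily.pi {M : ℕ} {ι : Type*} [Add ι] {A S : ι → ι → ι → ι → ℝ}
    (h : IsKrausFamily A S) : IsKrausFamily (modeProd (M := M) A) (modeProd S) where
  eq_zero n m j k hne := by
    obtain ⟨i, hi⟩ := Function.ne_iff.mp hne
    exact Finset.prod_eq_zero (Finset.mem_univ i) (h.eq_zero _ _ _ _ hi)
  hasSum_kernel n n' j j' := by
    rw [← (Equiv.arrowProdEquivProdArrow (Fin M) (fun _ => ι) (fun _ => ι)).hasSum_iff]
    refine (hasSum_pi_prod fun i => h.hasSum_kernel (n i) (n' i) (j i) (j' i)).congr_fun fun e => ?_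
    simp [modeProd, Equiv.arrowProdEquivProdArrow, Finset.prod_mul_distrib]
  hasSum_diag n := by
    simpa only [modeProd, Finset.prod_const_one] using
      hasSum_pi_prod fun i : Fin M => h.hasSum_diag (n i)

/-- The matrix elements of the Kraus operators of thermal loss, indexed by the numbers `m` of
background and `k` of environment photons. -/
def bsKraus (κ : unitInterval) (N : ℝ) (n m j k : ℕ) : ℝ :=
  √(thermalProb N m) * bsAmp κ n m j k

/-- The matrix elements of the Kraus operators of pure loss followed by quantum-limited
amplification, indexed by the numbers `a` of gained and `l` of lost photons. -/
def ampKraus (κ N : ℝ) (n a j l : ℕ) : ℝ :=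
  √((j.factorial : ℝ) / n.factorial) * √(ampWeight κ N a l) * ampCoeff κ N n a j l

section KrausFamilies

variable {N : ℝ} (hN : 0 ≤ N) (κ : unitInterval)
include hN

lemma isKrausFamily_bsKraus : IsKrausFamily (bsKraus κ N) (lossKernel κ N) where
  eq_zero n m j k h := by simp [bsKraus, bsAmp_eq, bsCoeff_eq_zero κ h]
  hasSum_kernel n n' j j' := by
    refine ((hasSum_bsTerm κ hN n n' j j').mul_left
      (√((j.factorial : ℝ) / n.factorial) * √((j'.factorial : ℝ) / n'.factorial))).congr_fun ?_
    rintro ⟨m, k⟩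
    have hsplit (j n : ℕ) : √((j.factorial * k.factorial : ℝ) / (n.factorial * m.factorial))
        = √((j.factorial : ℝ) / n.factorial) * √((k.factorial : ℝ) / m.factorial) := by
      rw [← Real.sqrt_mul (by positivity), div_mul_div_comm]
    have hprob := Real.mul_self_sqrt (thermalProb_nonneg hN m)
    have hfact : √((k.factorial : ℝ) / m.factorial) * √((k.factorial : ℝ) / m.factorial)
        = (k.factorial : ℝ) / m.factorial := Real.mul_self_sqrt (by positivity)
    simp only [bsKraus, bsAmp_eq, hsplit, bsTerm]
    linear_combination (√((j.factorial : ℝ) / n.factorial) * √((j'.factorial : ℝ) / n'.factorial)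
      * bsCoeff κ n m j k * bsCoeff κ n' m j' k)
      * (√((k.factorial : ℝ) / m.factorial) ^ 2 * hprob + thermalProb N m * hfact)
  hasSum_diag := hasSum_lossKernel hN

lemma ampWeight_nonneg (a l : ℕ) : 0 ≤ ampWeight κ N a l :=
  div_nonneg (mul_nonneg
    (div_nonneg (pow_nonneg (lossParam_nonneg hN κ) l) (Nat.cast_nonneg _))
    (div_nonneg (pow_nonneg (ampParam_nonneg hN κ) a) (Nat.cast_nonneg _))) (gain_pos hN κ).le

lemma isKrausFamily_ampKraus : IsKrausFamily (ampKraus κ N) (lossKernel κ N) where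
  eq_zero n m j k h := by rw [ampKraus, ampCoeff_eq_zero κ N h, mul_zero]
  hasSum_kernel n n' j j' := by
    rw [lossKernel, bsSum_eq_ampSum hN]
    refine ((hasSum_ampTerm κ N n n' j j').mul_left _).congr_fun ?_
    rintro ⟨a, l⟩
    have hweight := Real.mul_self_sqrt (ampWeight_nonneg hN κ a l)
    simp only [ampKraus, ampTerm]
    linear_combination (√((j.factorial : ℝ) / n.factorial) * √((j'.factorial : ℝ) / n'.factorial)
      * ampCoeff κ N n a j l * ampCoeff κ N n' a j' l) * hweight
  hasSum_diag := hasSum_lossKernel hN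

end KrausFamilies

section Ensembles

open InnerProductSpace

variable {M : ℕ} {B H : Type*} [NormedAddCommGroup H] [InnerProductSpace ℂ H] {N : ℝ}

lemma thermalPMF_eq_prod (N : ℝ) (n : Fin M → ℕ) : thermalPMF N n = ∏ i, thermalProb N (n i) := rfl

lemma thermalPMF_nonneg (hN : 0 ≤ N) (n : Fin M → ℕ) : 0 ≤ thermalPMF N n :=
  Finset.prod_nonneg fun _ _ => thermalProb_nonneg hN _

lemma hasSum_thermalPMF (hN : 0 ≤ N) : HasSum (thermalPMF (M := M) N) 1 := by
  have h := hasSum_pi_prod fun _ : Fin M => hasSum_thermalProb hN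
  rwa [Finset.prod_const_one] at h

lemma vec_bsKraus_eq (hN : 0 ≤ N) (κ : unitInterval) (ψ : Modes M H)
    (e : (Fin M → ℕ) × (Fin M → ℕ)) :
    (isKrausFamily_bsKraus hN κ).pi.vec ψ e
      = ((√(thermalPMF N e.1) : ℝ) : ℂ) • kraus κ e.1 e.2 ψ := by
  ext j
  change ((modeProd (bsKraus κ N) (j + e.2 - e.1) e.1 j e.2 : ℝ) : ℂ) • ψ (j + e.2 - e.1)
    = ((√(thermalPMF N e.1) : ℝ) : ℂ) • krausFun κ e.1 e.2 ψ j
  by_cases hle : e.1 ≤ j + e.2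
  · rw [krausFun, if_pos hle, smul_smul, ← Complex.ofReal_mul, thermalPMF_eq_prod,
      Real.sqrt_prod _ fun i _ => thermalProb_nonneg hN _, ← Finset.prod_mul_distrib]
    rfl
  · rw [krausFun, if_neg hle, smul_zero, (isKrausFamily_bsKraus hN κ).pi.eq_zero,
      Complex.ofReal_zero, zero_smul]
    exact fun h => hle (h ▸ le_add_self)

/-- The map `x ↦ √(p n) x ⊗ |n⟩`, where `p` is the thermal distribution. -/
def thermalKet (N : ℝ) (n : Fin M → ℕ) : H →L[ℂ] Modes M H :=
  ((√(thermalPMF N n) : ℝ) : ℂ) • tensorKet n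

lemma hasSum_norm_sq_thermalKet (hN : 0 ≤ N) (x : H) :
    HasSum (fun n : Fin M → ℕ => ‖thermalKet N n x‖ ^ 2) (‖x‖ ^ 2) := by
  have h := (hasSum_thermalPMF (M := M) hN).mul_right (‖x‖ ^ 2)
  rw [one_mul] at h
  refine h.congr_fun fun n => ?_
  simp only [thermalKet, smul_apply]
  rw [norm_smul, mul_pow, norm_tensorKet, Complex.norm_real, Real.norm_eq_abs, sq_abs,
    Real.sq_sqrt (thermalPMF_nonneg hN n)]

variable [CompleteSpace H]

lemma thermalLoss_eq_tsum (hN : 0 ≤ N) (κ : unitInterval) (X : Modes M H →L[ℂ] Modes M H) :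
    thermalLoss κ N X = ∑' e : (Fin M → ℕ) × (Fin M → ℕ),
      (((√(thermalPMF N e.1) : ℝ) : ℂ) • kraus κ e.1 e.2) ∘L X
        ∘L ContinuousLinearMap.adjoint (((√(thermalPMF N e.1) : ℝ) : ℂ) • kraus κ e.1 e.2) :=
  tsum_congr fun _ => smul_comp_comp_adjoint (thermalPMF_nonneg hN _) _ X

lemma IsEnsemble.thermalLoss (hN : 0 ≤ N) (κ : unitInterval) {v : B → Modes M H}
    {ρ : Modes M H →L[ℂ] Modes M H} (hv : IsEnsemble v ρ) :
    IsEnsemble (fun z : ((Fin M → ℕ) × (Fin M → ℕ)) × B =>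
      (isKrausFamily_bsKraus hN κ).pi.vec (v z.2) z.1) (thermalLoss κ N ρ) := by
  rw [thermalLoss_eq_tsum hN]
  simp only [vec_bsKraus_eq hN κ]
  refine hv.kraus (T := fun e : (Fin M → ℕ) × (Fin M → ℕ) =>
    ((√(thermalPMF N e.1) : ℝ) : ℂ) • CovertQI.kraus κ e.1 e.2) fun ψ => ?_
  exact ((isKrausFamily_bsKraus hN κ).pi.hasSum_norm_sq_vec ψ).congr_fun fun e => by
    rw [vec_bsKraus_eq hN κ, smul_apply]

lemma isEnsemble_thermalLoss_rankOne (hN : 0 ≤ N) (κ : unitInterval) {ψ : Modes M H}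
    (hψ : ‖ψ‖ = 1) :
    IsEnsemble ((isKrausFamily_ampKraus hN κ).pi.vec ψ) (thermalLoss κ N (rankOne ℂ ψ ψ)) := by
  refine .of_hasSum_norm_sq
    (by simpa [hψ] using (isKrausFamily_ampKraus hN κ).pi.hasSum_norm_sq_vec ψ) ?_
  rw [thermalLoss_eq_tsum hN,
    (isKrausFamily_ampKraus hN κ).pi.tsum_rankOne_vec_eq (isKrausFamily_bsKraus hN κ).pi]
  refine tsum_congr fun e => ?_
  rw [comp_rankOne_self_comp_adjoint, vec_bsKraus_eq hN κ, smul_apply]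

lemma isEnsemble_traceModes_rankOne {ψ : Modes M H} (hψ : ‖ψ‖ = 1) :
    IsEnsemble (fun n => ψ n) (traceModes (rankOne ℂ ψ ψ)) := by
  have hadjoint (n : Fin M → ℕ) : lp.singleContinuousLinearMap ℂ (fun _ => H) 2 n
      = ContinuousLinearMap.adjoint (lp.evalCLM ℂ (fun _ : Fin M → ℕ => H) 2 n) := by
    rw [← adjoint_tensorKet, ContinuousLinearMap.adjoint_adjoint, tensorKet]
  simp only [traceModes, hadjoint]
  exact isEnsemble_kraus_rankOne (T := fun n => lp.evalCLM ℂ (fun _ : Fin M → ℕ => H) 2 n)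
    hasSum_norm_sq_apply hψ

lemma tensorThermal_eq_tsum (hN : 0 ≤ N) (X : H →L[ℂ] H) :
    tensorThermal M N X
      = ∑' n, thermalKet N n ∘L X ∘L ContinuousLinearMap.adjoint (thermalKet N n) := by
  refine tsum_congr fun n => ?_
  rw [← adjoint_tensorKet]
  exact smul_comp_comp_adjoint (thermalPMF_nonneg hN n) _ X

lemma IsEnsemble.tensorThermal (hN : 0 ≤ N) {v : B → H} {ρ : H →L[ℂ] H} (hv : IsEnsemble v ρ) :
    IsEnsemble (fun z : (Fin M → ℕ) × B => thermalKet N z.1 (v z.2)) (tensorThermal M N ρ) := by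
  rw [tensorThermal_eq_tsum hN]
  exact hv.kraus (T := thermalKet (M := M) (H := H) N) (hasSum_norm_sq_thermalKet hN)

lemma isEnsemble_thermalState (hN : 0 ≤ N) :
    IsEnsemble (fun n : Fin M → ℕ => thermalKet N n (1 : ℂ)) (thermalState M N) := by
  have hone : (1 : ℂ →L[ℂ] ℂ) = rankOne ℂ (1 : ℂ) (1 : ℂ) := by ext; simp
  have h := isEnsemble_kraus_rankOne (T := thermalKet (M := M) (H := ℂ) N)
    (hasSum_norm_sq_thermalKet hN) (norm_one : ‖(1 : ℂ)‖ = 1)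
  rwa [← hone, ← tensorThermal_eq_tsum hN] at h

lemma hasSum_norm_sq_braH_onb (ψ : Modes M H) :
    HasSum (fun i => ‖braH (onb H i) ψ‖ ^ 2) (‖ψ‖ ^ 2) := by
  have h := (hasSum_tsum_swap_of_nonneg
    (f := fun z : (Fin M → ℕ) × basisSet H => ‖⟪onb H z.2, ψ z.1⟫_ℂ‖ ^ 2) (g := fun n => ‖ψ n‖ ^ 2)
    (fun _ => sq_nonneg _) (fun n => hasSum_norm_sq_inner (onb H) (ψ n)) (hasSum_norm_sq_apply ψ)).1
  exact h.congr_fun fun i => (hasSum_norm_sq_apply (braH (onb H i) ψ)).tsum_eq.symm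

lemma isEnsemble_traceAux_rankOne {ψ : Modes M H} (hψ : ‖ψ‖ = 1) :
    IsEnsemble (fun i => braH (onb H i) ψ) (traceAux (rankOne ℂ ψ ψ)) :=
  isEnsemble_kraus_rankOne (T := fun i => braH (onb H i)) hasSum_norm_sq_braH_onb hψ

end Ensembles

/-! ### Alice's error probability -/

lemma sqrt_pow {x : ℝ} (hx : 0 ≤ x) (n : ℕ) : √(x ^ n) = √x ^ n := by
  simpa using Real.sqrt_prod (Finset.range n) fun _ _ => hx

lemma Theta_nonneg (η N : ℝ) : 0 ≤ Theta η N := by unfold Theta; positivity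

section Overlap

variable {N : ℝ} (hN : 0 ≤ N) (η : unitInterval)
include hN

lemma lossParam_le_one : lossParam η N ≤ 1 := by
  rw [lossParam, div_le_one (gain_pos hN η), gain]
  linarith [η.2.1]

lemma Theta_eq_sqrt_lossParam : Theta η N = √(lossParam η N) := by
  rw [Theta, lossParam, gain, Real.sqrt_div]
  exact mul_nonneg (sub_nonneg.mpr η.2.2) (by positivity)

lemma Theta_le_one : Theta η N ≤ 1 := by
  rw [Theta_eq_sqrt_lossParam hN]
  exact Real.sqrt_le_one.mpr (lossParam_le_one hN η)

lemma ampKraus_diag (a l : ℕ) :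
    ampKraus η N l a a l = √(ampParam η N ^ a / gain η N) * Theta η N ^ l := by
  have hgain := gain_pos hN η
  have hloss := lossParam_nonneg hN η
  have hamp := ampParam_nonneg hN η
  have hweight := ampWeight_nonneg hN η a l
  have hvalue : (a.factorial / l.factorial : ℝ) * ampWeight η N a l * (l.factorial : ℝ) ^ 2
      = ampParam η N ^ a / gain η N * lossParam η N ^ l := by
    rw [ampWeight]; field_simp
  have hprefactor : √((a.factorial : ℝ) / l.factorial) * √(ampWeight η N a l) * l.factorial
      = √(ampParam η N ^ a / gain η N) * √(lossParam η N) ^ l := by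
    rw [← sqrt_pow hloss, ← Real.sqrt_mul (by positivity), ← Real.sqrt_mul (by positivity),
      ← hvalue, Real.sqrt_mul (by positivity) (_ ^ 2), Real.sqrt_sq (Nat.cast_nonneg _)]
  rw [ampKraus, ampCoeff, if_pos (add_comm l a), Nat.descFactorial_self, Nat.sub_self, pow_zero,
    mul_one, Theta_eq_sqrt_lossParam hN, hprefactor]

lemma hasSum_nu :
    HasSum (fun a : ℕ => √(thermalProb N a) * √(ampParam η N ^ a / gain η N)) (nu η N) := by
  have hgain := gain_pos hN η
  have hamp := ampParam_nonneg hN η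
  have hratio : √(N / (N + 1) * ampParam η N) < 1 := by
    rw [Real.sqrt_lt' one_pos, one_pow]
    exact mul_lt_one_of_nonneg_of_lt_one_left (by positivity) (div_add_one_lt_one hN)
      (ampParam_lt_one hN η).le
  have hvalue : (√((N + 1) * gain η N))⁻¹ * (1 - √(N / (N + 1) * ampParam η N))⁻¹ = nu η N := by
    have hGains : N / (N + 1) * ampParam η N
        = (N + 1 - 1) * (gain η N - 1) / ((N + 1) * gain η N) := by
      rw [ampParam, gain]; field_simp; ring
    rw [nu, show (1 - (η : ℝ)) * N + 1 = gain η N by rw [gain]; ring, hGains,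
      Real.sqrt_div' _ (by positivity), ← mul_inv, mul_one_sub,
      mul_div_cancel₀ _ (Real.sqrt_pos.mpr (by positivity)).ne']
  have hgeo := (hasSum_geometric_of_lt_one (Real.sqrt_nonneg _) hratio).mul_left
    (√((N + 1) * gain η N))⁻¹
  rw [hvalue] at hgeo
  refine hgeo.congr_fun fun a => ?_
  have hterm : thermalProb N a * (ampParam η N ^ a / gain η N)
      = ((N + 1) * gain η N)⁻¹ * (N / (N + 1) * ampParam η N) ^ a := by
    rw [thermalProb_eq, mul_pow, mul_inv]; ring
  rw [← Real.sqrt_mul (thermalProb_nonneg hN a), hterm, Real.sqrt_mul (by positivity),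
    Real.sqrt_inv, sqrt_pow (by positivity)]

end Overlap

namespace Probe

lemma summable_mul_prod_pow {M : ℕ} {I : Type*} [NormedAddCommGroup I] (P : Probe M I) {t : ℝ}
    (ht₀ : 0 ≤ t) (ht₁ : t ≤ 1) : Summable fun n => P.p n * ∏ i, t ^ n i :=
  P.p_sum.summable.of_nonneg_of_le (fun n => mul_nonneg (P.p_nonneg n) (by positivity))
    fun n => mul_le_of_le_one_right (P.p_nonneg n) (Finset.prod_le_one
      (fun _ _ => by positivity) fun _ _ => pow_le_one₀ ht₀ ht₁)

variable {M : ℕ} {I : Type*} [NormedAddCommGroup I] [InnerProductSpace ℂ I] (P : Probe M I)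

lemma norm_sq_ket_apply (n : Fin M → ℕ) : ‖P.ket n‖ ^ 2 = P.p n := by
  change ‖((√(P.p n) : ℝ) : ℂ) • P.χ n‖ ^ 2 = _
  rw [norm_smul, P.χ_norm, mul_one, Complex.norm_real, Real.norm_eq_abs, sq_abs,
    Real.sq_sqrt (P.p_nonneg n)]

lemma norm_ket : ‖P.ket‖ = 1 := by
  have h : ‖P.ket‖ ^ 2 = 1 := (hasSum_norm_sq_apply P.ket).unique
    (P.p_sum.congr_fun P.norm_sq_ket_apply)
  exact (pow_eq_one_iff_of_nonneg (norm_nonneg _) two_ne_zero).mp h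

variable {N : ℝ} (hN : 0 ≤ N) (η : unitInterval)
include hN

lemma inner_thermalKet_vec_ampKraus (e : (Fin M → ℕ) × (Fin M → ℕ)) :
    ⟪thermalKet N e.1 (P.ket e.2), (isKrausFamily_ampKraus hN η).pi.vec P.ket e⟫_ℂ
      = ((∏ i, √(thermalProb N (e.1 i)) * √(ampParam η N ^ e.1 i / gain η N))
        * (P.p e.2 * ∏ i, Theta η N ^ e.2 i) : ℝ) := by
  obtain ⟨a, l⟩ := e
  have hamp : √(thermalPMF N a) * modeProd (ampKraus η N) l a a l
      = (∏ i, √(thermalProb N (a i)) * √(ampParam η N ^ a i / gain η N))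
        * ∏ i, Theta η N ^ l i := by
    rw [thermalPMF_eq_prod, Real.sqrt_prod _ fun i _ => thermalProb_nonneg hN _, modeProd,
      ← Finset.prod_mul_distrib, ← Finset.prod_mul_distrib]
    exact Finset.prod_congr rfl fun i _ => by rw [ampKraus_diag hN, mul_assoc]
  rw [thermalKet, smul_apply, inner_smul_left, inner_tensorKet_left, Complex.conj_ofReal,
    IsKrausFamily.vec_apply]
  simp only [add_tsub_cancel_left]
  rw [inner_smul_right, inner_self_eq_norm_sq_to_K, mul_left_comm (∏ i, _) (P.p l), ← hamp,
    ← P.norm_sq_ket_apply]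
  push_cast
  rw [mul_comm (‖P.ket l‖ ^ 2 : ℂ), mul_assoc]
  rfl

lemma hasSum_overlap :
    HasSum (fun e : (Fin M → ℕ) × (Fin M → ℕ) => RCLike.re
        ⟪thermalKet N e.1 (P.ket e.2), (isKrausFamily_ampKraus hN η).pi.vec P.ket e⟫_ℂ)
      (nu η N ^ M * ∑' n, P.p n * ∏ i, Theta η N ^ n i) := by
  have h := hasSum_mul_prod (hasSum_pi_prod fun _ : Fin M => hasSum_nu hN η)
    (P.summable_mul_prod_pow (Theta_nonneg η N) (Theta_le_one hN η)).hasSum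
  rw [Finset.prod_const, Finset.card_univ, Fintype.card_fin] at h
  refine h.congr_fun fun e => ?_
  rw [P.inner_thermalKet_vec_ampKraus hN η]
  exact Complex.ofReal_re _

lemma le_aliceError [CompleteSpace I] :
    (1 - √(1 - (nu η N ^ M * ∑' n, P.p n * ∏ i, Theta η N ^ n i) ^ 2)) / 2
      ≤ P.aliceError η N := by
  have h := ((isEnsemble_traceModes_rankOne P.norm_ket).tensorThermal hN).traceNorm_sub_le
    (isEnsemble_thermalLoss_rankOne hN η P.norm_ket) (P.hasSum_overlap hN η)
  have hreal := ENNReal.toReal_le_of_le_ofReal (by positivity) h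
  rw [aliceError, errorProb, aliceAbsent, alicePresent, density]
  linarith

end Probe

/-! ### Willie's photon-number statistics -/

section Bhattacharyya

variable {ι : Type*}

lemma summable_sqrt_mul_and_tsum_le {a b : ι → ℝ} {A B : ℝ} (ha : ∀ i, 0 ≤ a i)
    (hb : ∀ i, 0 ≤ b i) (hA : HasSum a A) (hB : HasSum b B) :
    (Summable fun i => √(a i * b i)) ∧ ∑' i, √(a i * b i) ≤ √A * √B := by
  have h := Real.summable_and_inner_le_Lp_mul_Lq_tsum_of_nonneg
    (f := fun i => √(a i)) (g := fun i => √(b i)) Real.HolderConjugate.two_two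
    (fun _ => Real.sqrt_nonneg _) (fun _ => Real.sqrt_nonneg _)
  simp only [Real.rpow_ofNat, Real.sq_sqrt (ha _), Real.sq_sqrt (hb _), ← Real.sqrt_eq_rpow,
    ← Real.sqrt_mul (ha _), hA.tsum_eq, hB.tsum_eq] at h
  exact h hA.summable hB.summable

lemma min_le_sqrt_mul {a b : ℝ} (ha : 0 ≤ a) (hb : 0 ≤ b) : min a b ≤ √(a * b) :=
  Real.le_sqrt_of_sq_le (by
    rw [sq]
    exact mul_le_mul (min_le_left a b) (min_le_right a b) (le_min ha hb) ha)

lemma hasSum_min {p q : ι → ℝ} (hp : HasSum p 1) (hq : HasSum q 1) :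
    HasSum (fun i => min (p i) (q i)) (1 - (∑' i, |p i - q i|) / 2) := by
  have h := ((hp.add hq).sub (hp.summable.sub hq.summable).abs.hasSum).div_const 2
  rw [show (1 + 1 - ∑' i, |p i - q i|) / 2 = 1 - (∑' i, |p i - q i|) / 2 by ring] at h
  refine h.congr_fun fun i => ?_
  rcases abs_cases (p i - q i) with ⟨habs, hsign⟩ | ⟨habs, hsign⟩
  · rw [habs, min_eq_right (by linarith)]; ring
  · rw [habs, min_eq_left (by linarith)]; ring

lemma sq_one_sub_le_mul_of_tsum_abs_sub_le {p q a b : ι → ℝ} {A B ε : ℝ} (hp₀ : ∀ i, 0 ≤ p i)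
    (hq₀ : ∀ i, 0 ≤ q i) (hp : HasSum p 1) (hq : HasSum q 1) (hε : ε ≤ 1 / 2)
    (hdist : ∑' i, |p i - q i| ≤ 4 * ε) (ha : ∀ i, 0 ≤ a i) (hb : ∀ i, 0 ≤ b i)
    (hA : HasSum a A) (hB : HasSum b B) (hab : ∀ i, a i * b i = p i * q i) :
    (1 - 2 * ε) ^ 2 ≤ A * B := by
  obtain ⟨hs, hle⟩ := summable_sqrt_mul_and_tsum_le ha hb hA hB
  have hfidelity : 1 - (∑' i, |p i - q i|) / 2 ≤ ∑' i, √(a i * b i) := by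
    refine hasSum_le (fun i => ?_) (hasSum_min hp hq) hs.hasSum
    rw [hab]
    exact min_le_sqrt_mul (hp₀ i) (hq₀ i)
  calc (1 - 2 * ε) ^ 2 ≤ (√A * √B) ^ 2 := pow_le_pow_left₀ (by linarith) (by linarith) 2
    _ = A * B := by rw [mul_pow, Real.sq_sqrt (hA.nonneg ha), Real.sq_sqrt (hB.nonneg hb)]

end Bhattacharyya

section PhotonCounting

open InnerProductSpace

variable {ι E : Type*} [DecidableEq ι]

lemma tensorKet_apply {H : Type*} [NormedAddCommGroup H] [InnerProductSpace ℂ H] (k j : ι) (x : H) :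
    (tensorKet k x : lp (fun _ : ι => H) 2) j = Pi.single (M := fun _ => H) k x j :=
  lp.single_apply (E := fun _ : ι => H) 2 k x j

lemma orthonormal_tensorKet_one :
    Orthonormal ℂ fun j : ι => (tensorKet j (1 : ℂ) : lp (fun _ : ι => ℂ) 2) := by
  rw [orthonormal_iff_ite]
  intro j k
  rw [inner_tensorKet_left, tensorKet_apply, Pi.single_apply]
  split_ifs <;> simp

lemma IsEnsemble.inner_tensorKet_one {v : E → lp (fun _ : ι => ℂ) 2}
    {ρ : lp (fun _ : ι => ℂ) 2 →L[ℂ] lp (fun _ : ι => ℂ) 2} (h : IsEnsemble v ρ) {j : ι} {c : ℝ}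
    (hc : HasSum (fun e => ‖v e j‖ ^ 2) c) :
    ⟪tensorKet j (1 : ℂ), ρ (tensorKet j (1 : ℂ))⟫_ℂ = c := by
  refine (h.hasSum_inner 1 (tensorKet j (1 : ℂ)) (tensorKet j (1 : ℂ))).unique
    ((Complex.hasSum_ofReal.mpr hc).congr_fun fun e => ?_)
  rw [one_apply_eq_self, rankOne_apply, inner_smul_right, inner_tensorKet_left,
    inner_tensorKet_right]
  simp only [RCLike.inner_apply, map_one, mul_one, one_mul]
  rw [mul_comm, Complex.mul_conj, Complex.normSq_eq_norm_sq]

lemma inner_thermalState {M : ℕ} {N : ℝ} (hN : 0 ≤ N) (j : Fin M → ℕ) :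
    ⟪tensorKet j (1 : ℂ), thermalState M N (tensorKet j (1 : ℂ))⟫_ℂ = (thermalPMF N j : ℂ) := by
  refine (isEnsemble_thermalState hN).inner_tensorKet_one ?_
  refine (hasSum_ite_eq j (thermalPMF N j)).congr_fun fun n => ?_
  change ‖((√(thermalPMF N n) : ℝ) : ℂ) • (tensorKet n (1 : ℂ) : Modes M ℂ) j‖ ^ 2 = _
  rw [tensorKet_apply, Pi.single_apply, norm_smul, mul_pow, Complex.norm_real, Real.norm_eq_abs,
    sq_abs, Real.sq_sqrt (thermalPMF_nonneg hN n)]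
  rcases eq_or_ne n j with rfl | hne
  · simp
  · simp [hne, hne.symm]

end PhotonCounting

lemma hasSum_modeProd_lossKernel_mul_prod_pow {M : ℕ} {N : ℝ} (hN : 0 ≤ N) (κ : unitInterval)
    {x : ℝ} (hx₀ : 0 ≤ x) (hx₁ : x ≤ 1) (n : Fin M → ℕ) :
    HasSum (fun j => modeProd (lossKernel κ N) n n j j * ∏ i, x ^ j i)
      ((1 + (1 - κ) * N * (1 - x))⁻¹ ^ M
        * ∏ i, (1 + (x - 1) * κ / (1 + (1 - κ) * N * (1 - x))) ^ n i) := by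
  have h := hasSum_pi_prod fun i => hasSum_lossKernel_mul_pow (κ := κ) hN hx₀ hx₁ (n i)
  rw [Finset.prod_mul_distrib, Finset.prod_const, Finset.card_univ, Fintype.card_fin] at h
  exact h.congr_fun fun j => by rw [modeProd, Finset.prod_mul_distrib]

namespace Probe

open InnerProductSpace

variable {M : ℕ} {I : Type*} [NormedAddCommGroup I] [InnerProductSpace ℂ I]

/-- The photon-number distribution of the signal modes after the thermal loss channel. -/
def outputDist (P : Probe M I) (κ : unitInterval) (N : ℝ) (j : Fin M → ℕ) : ℝ :=
  ∑' n, modeProd (lossKernel κ N) n n j j * ‖P.ket n‖ ^ 2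

section OutputDist

variable (P : Probe M I) (κ : unitInterval) {N : ℝ} (hN : 0 ≤ N)
include hN

lemma outputDist_nonneg (j : Fin M → ℕ) : 0 ≤ P.outputDist κ N j :=
  tsum_nonneg fun n => mul_nonneg ((isKrausFamily_bsKraus hN κ).pi.kernel_diag_nonneg n j)
    (sq_nonneg _)

lemma hasSum_outputDist : HasSum (P.outputDist κ N) 1 := by
  have h := ((isKrausFamily_bsKraus hN κ).pi.hasSum_tsum_kernel_mul_norm_sq P.ket).1
  rwa [P.norm_ket, one_pow] at h

lemma hasSum_outputDist_mul_prod_pow {x t : ℝ} (hx₀ : 0 ≤ x) (hx₁ : x ≤ 1) (ht₀ : 0 ≤ t)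
    (ht₁ : t ≤ 1) (ht : 1 + (x - 1) * κ / (1 + (1 - κ) * N * (1 - x)) = t) :
    HasSum (fun j => P.outputDist κ N j * ∏ i, x ^ j i)
      ((1 + (1 - κ) * N * (1 - x))⁻¹ ^ M * ∑' n, P.p n * ∏ i, t ^ n i) := by
  have hfiber (n : Fin M → ℕ) := (hasSum_modeProd_lossKernel_mul_prod_pow hN κ hx₀ hx₁ n).mul_right
    (‖P.ket n‖ ^ 2)
  simp only [ht] at hfiber
  have htotal := (P.summable_mul_prod_pow ht₀ ht₁).hasSum.mul_left
    ((1 + (1 - κ) * N * (1 - x))⁻¹ ^ M)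
  refine (hasSum_tsum_swap_of_nonneg (f := fun z : (Fin M → ℕ) × (Fin M → ℕ) =>
    modeProd (lossKernel κ N) z.1 z.1 z.2 z.2 * (∏ i, x ^ z.2 i) * ‖P.ket z.1‖ ^ 2)
    (fun z => ?_) hfiber (htotal.congr_fun fun n => ?_)).1.congr_fun fun j => ?_
  · exact mul_nonneg (mul_nonneg ((isKrausFamily_bsKraus hN κ).pi.kernel_diag_nonneg _ _)
      (by positivity)) (sq_nonneg _)
  · rw [P.norm_sq_ket_apply]; ring
  · rw [outputDist, ← tsum_mul_right]
    exact tsum_congr fun n => by ring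

variable [CompleteSpace I]

lemma hasSum_norm_sq_vec_braH_apply (j : Fin M → ℕ) :
    HasSum (fun z : ((Fin M → ℕ) × (Fin M → ℕ)) × basisSet I =>
      ‖(isKrausFamily_bsKraus hN κ).pi.vec (braH (onb I z.2) P.ket) z.1 j‖ ^ 2)
      (P.outputDist κ N j) := by
  have hK := (isKrausFamily_bsKraus hN κ).pi (M := M)
  have hbasis := (hasSum_tsum_swap_of_nonneg (f := fun z : (Fin M → ℕ) × basisSet I =>
    modeProd (lossKernel κ N) z.1 z.1 j j * ‖⟪onb I z.2, P.ket z.1⟫_ℂ‖ ^ 2)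
    (g := fun n => modeProd (lossKernel κ N) n n j j * ‖P.ket n‖ ^ 2)
    (fun _ => mul_nonneg (hK.kernel_diag_nonneg _ _) (sq_nonneg _))
    (fun n => (hasSum_norm_sq_inner (onb I) (P.ket n)).mul_left _)
    (hK.hasSum_tsum_kernel_mul_norm_sq P.ket |>.2 j).hasSum).1
  exact (Equiv.prodComm _ _).hasSum_iff.mp (hasSum_prod_of_nonneg
    (f := fun z : basisSet I × ((Fin M → ℕ) × (Fin M → ℕ)) =>
      ‖hK.vec (braH (onb I z.1) P.ket) z.2 j‖ ^ 2) (fun _ => sq_nonneg _)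
    (fun i => hK.hasSum_norm_sq_vec_apply (braH (onb I i) P.ket) j) hbasis)

end OutputDist

lemma IsCovert.tsum_abs_sub_le [CompleteSpace I] {P : Probe M I} {η : unitInterval} {N ε : ℝ}
    (h : P.IsCovert η N ε) (hN : 0 ≤ N) :
    ∑' j, |thermalPMF N j - P.outputDist (unitInterval.symm η) N j| ≤ 4 * ε := by
  have hthermal := isEnsemble_thermalState (M := M) hN
  have hprobed : IsEnsemble _ (P.willieProbed η N) :=
    (isEnsemble_traceAux_rankOne P.norm_ket).thermalLoss hN (unitInterval.symm η)
  have hle := tsum_norm_inner_le_traceNorm orthonormal_tensorKet_one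
    (hthermal.isSelfAdjoint.sub hprobed.isSelfAdjoint)
  have hdiag (j : Fin M → ℕ) : ‖⟪tensorKet j (1 : ℂ), (thermalState M N - P.willieProbed η N)
      (tensorKet j (1 : ℂ))⟫_ℂ‖
      = |thermalPMF N j - P.outputDist (unitInterval.symm η) N j| := by
    rw [sub_apply, inner_sub_right, inner_thermalState hN, hprobed.inner_tensorKet_one
      (P.hasSum_norm_sq_vec_braH_apply _ hN j), ← Complex.ofReal_sub, Complex.norm_real,
      Real.norm_eq_abs]
  have hsummable := ((hasSum_thermalPMF hN).summable.sub
    (P.hasSum_outputDist (unitInterval.symm η) hN).summable).abs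
  simp_rw [hdiag] at hle
  rw [← ENNReal.ofReal_tsum_of_nonneg (fun _ => abs_nonneg _) hsummable,
    ENNReal.ofReal_le_iff_le_toReal (hthermal.traceNorm_sub_ne_top hprobed)] at hle
  rw [IsCovert, willieError, errorProb] at h
  linarith

end Probe

/-! ### The constants of the bound -/

section Constants

variable {N : ℝ} (hN : 0 ≤ N) {η : unitInterval}
include hN

lemma one_sub_Theta_mul (η : unitInterval) :
    (1 - Theta η N) * ((1 + Theta η N) * gain η N) = η := by
  have hsq : Theta η N ^ 2 = lossParam η N := by
    rw [Theta_eq_sqrt_lossParam hN, Real.sq_sqrt (lossParam_nonneg hN η)]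
  have hmul : lossParam η N * gain η N = (1 - η) * (N + 1) :=
    div_mul_cancel₀ _ (gain_pos hN η).ne'
  have hgain : gain η N = 1 + (1 - η) * N := rfl
  linear_combination (-gain η N) * hsq - hmul + hgain

lemma seven_tenths_le_Theta (hη : (η : ℝ) ≤ 2 / 5) : 7 / 10 ≤ Theta η N := by
  rw [Theta_eq_sqrt_lossParam hN]
  refine Real.le_sqrt_of_sq_le ?_
  rw [lossParam, le_div_iff₀ (gain_pos hN η), gain]
  nlinarith [mul_nonneg hN (sub_nonneg.mpr η.2.2)]

lemma one_sub_Theta_mul_add_one_le_xDenom (hη : (η : ℝ) ≤ 2 / 5) :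
    (1 - Theta η N) * (N + 1) ≤ xDenom η N := by
  have hΘ := seven_tenths_le_Theta hN hη
  have hgain := gain_pos hN η
  have hpos : 0 < (1 + Theta η N) * gain η N := by positivity
  have hquadratic : (η : ℝ) * (1 + η) ≤ (1 - η) * (17 / 10) * (1 - η) := by nlinarith [η.2.1]
  have hbound : (1 - Theta η N) * (N + 1 + η * N) ≤ 1 - η := by
    rw [eq_div_of_mul_eq hpos.ne' (one_sub_Theta_mul hN η), div_mul_eq_mul_div, div_le_iff₀ hpos]
    calc η * (N + 1 + η * N) ≤ (1 - η) * (17 / 10 * gain η N) := by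
          rw [gain]
          linarith [mul_le_mul_of_nonneg_right hquadratic hN]
      _ ≤ (1 - η) * ((1 + Theta η N) * gain η N) := by gcongr <;> linarith
  rw [xDenom]
  linarith

lemma xDenom_pos (hη : (η : ℝ) ≤ 2 / 5) : 0 < xDenom η N := by
  rcases (Theta_le_one hN η).eq_or_lt with hΘ | hΘ
  · rw [xDenom, hΘ]
    linarith
  · exact (mul_pos (sub_pos.mpr hΘ) (by positivity)).trans_le
      (one_sub_Theta_mul_add_one_le_xDenom hN hη)

lemma convergenceCondition_of_le_two_fifths (hη : (η : ℝ) ≤ 2 / 5) :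
    ConvergenceCondition η N := by
  have hpos := xDenom_pos hN hη
  refine ⟨hpos.ne', ?_, sub_le_self _ (div_nonneg (sub_nonneg.mpr (Theta_le_one hN η)) hpos.le)⟩
  have hle : (1 - Theta η N) / xDenom η N ≤ 1 / (N + 1) := by
    rw [div_le_div_iff₀ hpos (by positivity), one_mul]
    exact one_sub_Theta_mul_add_one_le_xDenom hN hη
  calc N / (N + 1) = 1 - 1 / (N + 1) := by field_simp; ring
    _ ≤ xVal η N := sub_le_sub_left hle 1

lemma nu_nonneg (η : unitInterval) : 0 ≤ nu η N :=
  (hasSum_nu hN η).nonneg fun _ => by positivity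

lemma eq_zero_of_div_add_one_nonpos (h : N / (N + 1) ≤ 0) : N = 0 := by
  by_contra hne
  have hpos := hN.lt_of_ne' hne
  exact h.not_gt (div_pos hpos (by positivity))

lemma add_one_sub_div_nonneg {x : ℝ} (hx : N / (N + 1) ≤ x) : 0 ≤ N + 1 - N / x := by
  have hx₀ : 0 ≤ x := le_trans (by positivity) hx
  rcases hx₀.eq_or_lt with rfl | hpos
  · simp [hN, add_nonneg]
  · exact sub_nonneg.mpr ((div_le_comm₀ (by positivity) hpos).mp hx)

lemma ConvergenceCondition.one_add_mul_pos (h : ConvergenceCondition η N) :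
    0 < 1 + η * N * (1 - xVal η N) :=
  add_pos_of_pos_of_nonneg one_pos
    (mul_nonneg (mul_nonneg η.2.1 hN) (sub_nonneg.mpr h.2.2))

lemma ConvergenceCondition.fVal_nonneg (h : ConvergenceCondition η N) : 0 ≤ fVal η N := by
  rw [fVal, add_comm (η * N * (1 - xVal η N))]
  exact mul_nonneg (mul_nonneg (nu_nonneg hN η) (add_one_sub_div_nonneg hN h.2.1))
    (h.one_add_mul_pos hN).le

lemma hasSum_thermalProb_mul_inv_pow {x : ℝ} (hx₀ : 0 ≤ x) (hx : 0 < N + 1 - N / x) :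
    HasSum (fun j => thermalProb N j * x⁻¹ ^ j) (N + 1 - N / x)⁻¹ := by
  have hN₁ : 0 < N + 1 := by positivity
  have hratio : N / (N + 1) * x⁻¹ = N / x / (N + 1) := by ring
  have hlt : N / (N + 1) * x⁻¹ < 1 := by
    rw [hratio, div_lt_one hN₁]
    linarith
  have h := (hasSum_geometric_of_lt_one (by positivity) hlt).mul_left (N + 1)⁻¹
  rw [← mul_inv, hratio, mul_sub, mul_one, mul_div_cancel₀ _ hN₁.ne', ← hratio] at h
  exact h.congr_fun fun j => by rw [thermalProb_eq, mul_pow, mul_assoc]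

end Constants

/-- The value `xVal` is chosen so that the generating function of Willie's photon counts at `xVal`
evaluates that of the probe at `Theta`. -/
lemma one_add_xVal_sub_one_mul_div {η N : ℝ} (hη : η < 1) (hd : xDenom η N ≠ 0) :
    1 + (xVal η N - 1) * (1 - η) / (1 + η * N * (1 - xVal η N)) = Theta η N := by
  have hη' : 1 - η ≠ 0 := by linarith
  have hden : 1 + η * N * (1 - xVal η N) = (1 - η) / xDenom η N := by
    rw [xVal]
    field_simp
    rw [xDenom]
    ring
  rw [hden, xVal]
  field_simp
  ring

/-! ### Covertness limits the energy of the probe -/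

lemma thermalPMF_mul_prod_inv_pow_mul_prod_pow {M : ℕ} {N x : ℝ} (hNx : x = 0 → N = 0)
    (j : Fin M → ℕ) : thermalPMF N j * ((∏ i, x⁻¹ ^ j i) * ∏ i, x ^ j i) = thermalPMF N j := by
  simp only [thermalPMF_eq_prod, ← Finset.prod_mul_distrib]
  refine Finset.prod_congr rfl fun i _ => ?_
  rcases eq_or_ne x 0 with rfl | hx
  · rcases eq_or_ne (j i) 0 with hj | hj
    · simp [hj]
    · simp [thermalProb, hNx rfl, hj]
  · rw [← mul_pow, inv_mul_cancel₀ hx, one_pow, mul_one]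

namespace Probe

variable {M : ℕ} {I : Type*} [NormedAddCommGroup I] [InnerProductSpace ℂ I] [CompleteSpace I]
  {P : Probe M I} {η : unitInterval} {N ε : ℝ}

lemma IsCovert.sq_one_sub_le (h : P.IsCovert η N ε) (hN : 0 ≤ N) (hη : (η : ℝ) < 1)
    (hcc : ConvergenceCondition η N) (hε : ε ≤ 1 / 2) (hpos : 0 < N + 1 - N / xVal η N) :
    (1 - 2 * ε) ^ 2 ≤ (N + 1 - N / xVal η N)⁻¹ ^ M *
      ((1 + η * N * (1 - xVal η N))⁻¹ ^ M * ∑' n, P.p n * ∏ i, Theta η N ^ n i) := by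
  obtain ⟨hd, hxl, hx₁⟩ := hcc
  have hx₀ : 0 ≤ xVal η N := le_trans (by positivity) hxl
  have hNx (hx : xVal η N = 0) : N = 0 := eq_zero_of_div_add_one_nonpos hN (hx ▸ hxl)
  have hthermal : HasSum (fun j : Fin M → ℕ => thermalPMF N j * ∏ i, (xVal η N)⁻¹ ^ j i)
      ((N + 1 - N / xVal η N)⁻¹ ^ M) := by
    have hprod := hasSum_pi_prod fun _ : Fin M => hasSum_thermalProb_mul_inv_pow hN hx₀ hpos
    rw [Finset.prod_const, Finset.card_univ, Fintype.card_fin] at hprod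
    exact hprod.congr_fun fun j => by rw [thermalPMF_eq_prod, Finset.prod_mul_distrib]
  have hprobed := P.hasSum_outputDist_mul_prod_pow (unitInterval.symm η) hN hx₀ hx₁
    (Theta_nonneg η N) (Theta_le_one hN η) (by
      rw [unitInterval.coe_symm_eq, sub_sub_cancel]
      exact one_add_xVal_sub_one_mul_div hη hd)
  rw [unitInterval.coe_symm_eq, sub_sub_cancel] at hprobed
  have hdist₀ := P.outputDist_nonneg (unitInterval.symm η) hN
  refine sq_one_sub_le_mul_of_tsum_abs_sub_le (thermalPMF_nonneg hN) hdist₀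
    (hasSum_thermalPMF hN) (P.hasSum_outputDist _ hN) hε (h.tsum_abs_sub_le hN)
    (fun j => mul_nonneg (thermalPMF_nonneg hN j) (by positivity))
    (fun j => mul_nonneg (hdist₀ j) (by positivity)) hthermal hprobed fun j => ?_
  conv_rhs => rw [← thermalPMF_mul_prod_inv_pow_mul_prod_pow hNx j]
  ring

lemma IsCovert.nonneg (h : P.IsCovert η N ε) (hN : 0 ≤ N) : 0 ≤ ε := by
  have hdist := (tsum_nonneg fun _ => abs_nonneg _).trans (h.tsum_abs_sub_le hN)
  linarith

lemma IsCovert.sq_mul_fVal_pow_le (h : P.IsCovert η N ε) (hN : 0 ≤ N) (hη : (η : ℝ) < 1)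
    (hcc : ConvergenceCondition η N) (hε : ε ≤ 1 / 2) :
    (1 - 2 * ε) ^ 2 * fVal η N ^ M ≤ nu η N ^ M * ∑' n, P.p n * ∏ i, Theta η N ^ n i := by
  have hν : 0 ≤ nu η N ^ M := pow_nonneg (nu_nonneg hN η) M
  have hf : fVal η N = nu η N * ((N + 1 - N / xVal η N) * (1 + η * N * (1 - xVal η N))) := by
    rw [fVal]
    ring
  rw [hf, mul_pow, mul_left_comm]
  refine mul_le_mul_of_nonneg_left ?_ hν
  rcases (add_one_sub_div_nonneg hN hcc.2.1).eq_or_lt with hzero | hpos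
  · rw [← hzero, zero_mul]
    rcases Nat.eq_zero_or_pos M with rfl | hM
    · have hε₀ := h.nonneg hN
      simp only [pow_zero, mul_one, Finset.univ_eq_empty, Finset.prod_empty, P.p_sum.tsum_eq]
      exact pow_le_one₀ (by linarith) (by linarith)
    · rw [zero_pow hM.ne', mul_zero]
      exact tsum_nonneg fun n => mul_nonneg (P.p_nonneg n)
        (Finset.prod_nonneg fun i _ => pow_nonneg (Theta_nonneg _ _) _)
  · have hpos' := mul_pos hpos (hcc.one_add_mul_pos hN)
    rw [← le_div_iff₀ (pow_pos hpos' M), div_eq_inv_mul, ← inv_pow, mul_inv, mul_pow, mul_assoc]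
    exact h.sq_one_sub_le hN hη hcc hε hpos

end Probe

end CovertQI

end

theorem mainTheorem1 (η : unitInterval) (hη0 : 0 < (η : ℝ)) (hη1 : (η : ℝ) < 1)
    (N_B : ℝ) (hN : 0 ≤ N_B) :
    ((η : ℝ) ≤ 2 / 5 → CovertQI.ConvergenceCondition η N_B) ∧
    (CovertQI.ConvergenceCondition η N_B →
      ∀ (M : ℕ) (I : Type*) [NormedAddCommGroup I] [InnerProductSpace ℂ I] [CompleteSpace I]
        (P : CovertQI.Probe M I) (ε : ℝ), 0 ≤ ε → ε ≤ 1 / 2 → P.IsCovert η N_B ε →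
        (1 - √(1 - (1 - 2 * ε) ^ 4 * CovertQI.fVal η N_B ^ (2 * M))) / 2
          ≤ P.aliceError η N_B) := by
  refine ⟨CovertQI.convergenceCondition_of_le_two_fifths hN,
    fun hcc M I _ _ _ P ε _ hε hcov => le_trans ?_ (P.le_aliceError hN η)⟩
  have hsq : (1 - 2 * ε) ^ 4 * CovertQI.fVal η N_B ^ (2 * M)
      = ((1 - 2 * ε) ^ 2 * CovertQI.fVal η N_B ^ M) ^ 2 := by ring
  have hnonneg : 0 ≤ (1 - 2 * ε) ^ 2 * CovertQI.fVal η N_B ^ M :=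
    mul_nonneg (sq_nonneg _) (pow_nonneg (hcc.fVal_nonneg hN) M)
  have hle := pow_le_pow_left₀ hnonneg (hcov.sq_mul_fVal_pow_le hN hη1 hcc hε) 2
  rw [hsq]
  gcongr
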